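/- Let $Q$ be a finite-dimensional smooth manifold with projections $\tau_Q:TQ\to Q$, $\pi_Q:T^*Q\to Q$, and let $pr_1, pr_2, pr$ be the projections of the Whitney sum $TQ\oplus T^*Q$ onto $TQ$, $T^*Q$ and $Q$. Let $\Omega_Q=-d\theta$ be the canonical symplectic form of $T^*Q$ ($\theta$ the Liouville form; $\Omega_Q=dq^A\wedge dp_A$ in canonical coordinates). Let $L:TQ\to\mathbb R$ be a smooth function with Legendre transformation $FL:TQ\to T^*Q$, $FL(q,v)=(q,\partial L/\partial v)$, and energy $E_L(v)=\langle FL(v),v\rangle-L(v)$. Assume that $L$ is almost regular: $M_1=\mathrm{Im}\,FL$ is an embedded submanifold of $T^*Q$ and $FL:TQ\to M_1$ is a submersion with connected fibres. Let $h_1:M_1\to\mathbb R$ be the function with $h_1\circ FL=E_L$, let $\Omega_1$ be the restriction of $\Omega_Q$ to $M_1$, and put on $W_0=TQ\oplus T^*Q$ $$\Omega=pr_2^*\Omega_Q,\qquad D(v_q,\alpha_q)=\alpha_q(v_q)-L(v_q).$$ The Gotay–Nester–Hinds algorithm produces the sequences $$W_{k+1}=\{x\in W_k:\ \exists X\in T_xW_k,\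 i_X\Omega=dD\}\ (k\ge 0),\qquad M_{k+1}=\{y\in M_k:\ \exists Y\in T_yM_k,\ i_Y\Omega_1=dh_1\}\ (k\ge 1).$$ (i) If $p\in W_1$ and $X\in T_pW_1$ satisfies $i_X\Omega=dD$, then $X_2=T_ppr_2(X)$ lies in $T_{pr_2(p)}M_1$ and satisfies $i_{X_2}\Omega_1=dh_1$. Assume moreover, as is usual for the algorithm, that all $W_k$ and all $M_k$ are embedded submanifolds. (ii) For every $k\ge 1$ we have $pr_2(W_k)\subset M_k$. Suppose that both algorithms stabilize (possibly at different steps), $W_i=W_{i+1}$ and $M_j=M_{j+1}$, and call $W_f=W_i$ and $M_f=M_j$ the final constraint submanifolds. Suppose also that $i_Y\Omega_1=dh_1$ has a smooth solution tangent to $M_f$ near each point of $M_f$, that is, each point of $M_f$ has a neighbourhood in $M_f$ carrying a smooth vector field $Y$, tangent to $M_f$, with $i_Y\Omega_1=dh_1$. Then $pr_2(W_f)=M_f$. (iii) Under the assumptions of (ii), $pr(W_f)=\pi_Q(M_f)$; this common set is denoted by $Q_f$. -/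

import Mathlib

open Set Bundle
open scoped Manifold ContDiff Topology

noncomputable section

namespace SkinnerRusk

section Submanifolds

/-! Subsets of a boundaryless manifold `N`: embedded submanifolds, tangent vectors,
the equation `i_X η = dh` on a submanifold, and the Gotay–Nester–Hinds algorithm. -/

variable {F : Type*} [NormedAddCommGroup F] [NormedSpace ℝ F]
  {H : Type*} [TopologicalSpace H] (I : ModelWithCorners ℝ F H)
  {N : Type*} [TopologicalSpace N] [ChartedSpace H N]

/-- `S` is an embedded (`C^∞`) submanifold: around each of its points there is a chart of `N` in
which `S` is a piece of an affine subspace.  (The dimension may depend on the component.) -/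
def IsEmbeddedSubmanifold (S : Set N) : Prop :=
  ∀ x ∈ S, ∃ e ∈ IsManifold.maximalAtlas I ∞ N, x ∈ e.source ∧ ∃ V : Submodule ℝ F,
    ∀ y ∈ e.source, (y ∈ S ↔ e.extend I y - e.extend I x ∈ V)

/-- `γ` is a smooth curve `(-ε, ε) → S` with `γ 0 = x` and velocity `Z` at time `0`. -/
def IsCurveIn (S : Set N) (x : N) (Z : TangentSpace I x) (γ : ℝ → N) : Prop :=
  (∃ ε > 0, ContMDiffOn 𝓘(ℝ, ℝ) I ∞ γ (Ioo (-ε) ε) ∧ ∀ t ∈ Ioo (-ε) ε, γ t ∈ S) ∧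
    tangentMap 𝓘(ℝ, ℝ) I γ ⟨(0 : ℝ), (1 : ℝ)⟩ = (⟨x, Z⟩ : TangentBundle I N)

/-- `T_x S`: the velocities at `x` of the smooth curves in `S` through `x`. -/
def tangentTo (S : Set N) (x : N) : Set (TangentSpace I x) :=
  {Z | ∃ γ : ℝ → N, IsCurveIn I S x Z γ}

/-- The equation `i_X η = dh` on the submanifold `S`, at the point `x ∈ S`: for each `Z ∈ T_x S`,
the derivative of `h` along every smooth curve in `S` through `x` with velocity `Z`
exists and equals `η(X, Z)`.  Only the values of `h` on `S` matter. -/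
def Solves (S : Set N) (η : ∀ x : N, TangentSpace I x → TangentSpace I x → ℝ) (h : N → ℝ)
    (x : N) (X : TangentSpace I x) : Prop :=
  ∀ (Z : TangentSpace I x) (γ : ℝ → N), IsCurveIn I S x Z γ → HasDerivAt (h ∘ γ) (η x X Z) 0

/-- The sequence of constraint subsets `C_0 = S`,
`C_{k+1} = {x ∈ C_k | there is X ∈ T_x C_k with i_X η = dh}` which the Gotay–Nester–Hinds algorithm
produces from the presymplectic system `(S, η|_S, dh)`. -/
def constraintSet (S : Set N) (η : ∀ x : N, TangentSpace I x → TangentSpace I x → ℝ)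
    (h : N → ℝ) : ℕ → Set N
  | 0 => S
  | k + 1 => {x | x ∈ constraintSet S η h k ∧
      ∃ X ∈ tangentTo I (constraintSet S η h k) x, Solves I S η h x X}

/-- The exterior derivative `dθ(v, w)` at `x` of a 1-form `θ` on a boundaryless manifold,
computed in the chart `φ` around `x`:
if `θ'` is the representative of `θ` in this chart and `v'`, `w'` those of `v`, `w`, then
`dθ(v, w) = (D θ' v') w' - (D θ' w') v'`. -/
def extDerivOneForm (θ : ∀ y : N, TangentSpace I y →L[ℝ] ℝ) (x : N) (v w : TangentSpace I x) : ℝ :=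
  let φ := extChartAt I x
  let θ' : F → F →L[ℝ] ℝ := fun z => (θ (φ.symm z)).comp (mfderiv 𝓘(ℝ, F) I φ.symm z)
  let v' : F := mfderiv I 𝓘(ℝ, F) φ x v
  let w' : F := mfderiv I 𝓘(ℝ, F) φ x w
  fderiv ℝ θ' (φ x) v' w' - fderiv ℝ θ' (φ x) w' v'

end Submanifolds

variable (E : Type*) [NormedAddCommGroup E] [NormedSpace ℝ E]
  (Q : Type*) [TopologicalSpace Q] [ChartedSpace E Q] [IsManifold 𝓘(ℝ, E) ∞ Q]

/-- The tangent bundle `TQ`. -/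
abbrev TQ : Type _ := TangentBundle 𝓘(ℝ, E) Q

/-- The fibre `T_q^*Q` of the cotangent bundle. -/
abbrev CotangentSpace (q : Q) : Type _ := TangentSpace 𝓘(ℝ, E) q →L[ℝ] ℝ

/-- The cotangent bundle `T^*Q`. -/
abbrev TstarQ : Type _ := TotalSpace (E →L[ℝ] ℝ) (CotangentSpace E Q)

/-- The Whitney sum `TQ ⊕ T^*Q`. -/
abbrev Whitney : Type _ :=
  TotalSpace (E × (E →L[ℝ] ℝ)) ((TangentSpace 𝓘(ℝ, E) : Q → Type _) ×ᵇ CotangentSpace E Q)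

/-- Model of `TQ`. -/
abbrev ITan : ModelWithCorners ℝ (E × E) (ModelProd E E) := 𝓘(ℝ, E).prod 𝓘(ℝ, E)

/-- Model of `T^*Q`. -/
abbrev ICot : ModelWithCorners ℝ (E × (E →L[ℝ] ℝ)) (ModelProd E (E →L[ℝ] ℝ)) :=
  𝓘(ℝ, E).prod 𝓘(ℝ, E →L[ℝ] ℝ)

/-- Model of `TQ ⊕ T^*Q`. -/
abbrev IWh : ModelWithCorners ℝ (E × (E × (E →L[ℝ] ℝ))) (ModelProd E (E × (E →L[ℝ] ℝ))) :=
  𝓘(ℝ, E).prod 𝓘(ℝ, E × (E →L[ℝ] ℝ))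

variable {E Q}

/-- `π_Q : T^*Q → Q`. -/
def piQ (α : TstarQ E Q) : Q := α.proj

/-- `pr : TQ ⊕ T^*Q → Q`. -/
def pr (x : Whitney E Q) : Q := x.proj

/-- `pr₁ : TQ ⊕ T^*Q → TQ`. -/
def pr₁ (x : Whitney E Q) : TQ E Q := ⟨x.proj, x.2.1⟩

/-- `pr₂ : TQ ⊕ T^*Q → T^*Q`. -/
def pr₂ (x : Whitney E Q) : TstarQ E Q := ⟨x.proj, x.2.2⟩

/-- The canonical (Liouville) 1-form of `T^*Q`: `θ_α(X) = α(Tπ_Q X)`. -/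
def liouvilleForm (α : TstarQ E Q) : TangentSpace (ICot E) α →L[ℝ] ℝ :=
  ContinuousLinearMap.comp (α.2 : TangentSpace 𝓘(ℝ, E) α.proj →L[ℝ] ℝ)
    (mfderiv (ICot E) 𝓘(ℝ, E) (piQ : TstarQ E Q → Q) α)

/-- The canonical symplectic form `Ω_Q = -dθ` of `T^*Q`, in canonical coordinates `dq^A ∧ dp_A`. -/
def OmegaQ (α : TstarQ E Q) (X Z : TangentSpace (ICot E) α) : ℝ :=
  -extDerivOneForm (ICot E) (liouvilleForm (E := E) (Q := Q)) α X Z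

/-- `Ω = pr₂^* Ω_Q` on `TQ ⊕ T^*Q`. -/
def Omega (x : Whitney E Q) (X Z : TangentSpace (IWh E) x) : ℝ :=
  OmegaQ (pr₂ x) (mfderiv (IWh E) (ICot E) pr₂ x X) (mfderiv (IWh E) (ICot E) pr₂ x Z)

variable (L : TQ E Q → ℝ)

/-- The Legendre transformation `FL : TQ → T^*Q`: `FL(v)` is the derivative at `v` of the
restriction of `L` to the tangent space containing `v`, i.e. `(q, v) ↦ (q, ∂L/∂v)`. -/
def FL (v : TQ E Q) : TstarQ E Q :=
  ⟨v.proj, fderiv ℝ (fun w : TangentSpace 𝓘(ℝ, E) v.proj => L ⟨v.proj, w⟩) v.2⟩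

/-- The energy `E_L = Δ(L) - L`, i.e. `E_L(v) = FL(v)(v) - L(v)`. -/
def energy (v : TQ E Q) : ℝ := (FL L v).2 v.2 - L v

/-- The Pontryagin hamiltonian `D(X_q, α_q) = α_q(X_q) - L(X_q)`. -/
def D (x : Whitney E Q) : ℝ := x.2.2 x.2.1 - L (pr₁ x)

/-- `L` is almost regular: `M₁ = Im FL` is a submanifold of `T^*Q`, and `FL : TQ → M₁` is a
submersion with connected fibres. -/
structure AlmostRegular : Prop where
  submanifold : IsEmbeddedSubmanifold (ICot E) (range (FL L))
  submersion : ∀ v : TQ E Q, ∀ Z ∈ tangentTo (ICot E) (range (FL L)) (FL L v),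
    ∃ U : TangentSpace (ITan E) v, mfderiv (ITan E) (ICot E) (FL L) v U = Z
  connected_fibres : ∀ α ∈ range (FL L), IsConnected (FL L ⁻¹' {α})

/-- The function `h₁ : M₁ → ℝ` with `h₁ ∘ FL = E_L`, extended by `0` outside `M₁ = Im FL`.  (For an
almost regular `L` the energy is constant on the connected fibres of `FL`, so that `h₁ ∘ FL = E_L`
does hold.) -/
def h₁ : TstarQ E Q → ℝ := Function.extend (FL L) (energy L) 0

/-- The constraint sets `W_0 = TQ ⊕ T^*Q ⊇ W_1 ⊇ W_2 ⊇ …` of `(TQ ⊕ T^*Q, Ω, dD)`. -/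
def W (k : ℕ) : Set (Whitney E Q) := constraintSet (IWh E) univ Omega (D L) k

/-- The constraint sets `M_1 = Im FL ⊇ M_2 ⊇ …` of `(M_1, Ω_1, dh_1)`, where `Ω_1` is the
restriction of `Ω_Q` to `M_1`; the numbering starts at `k = 1`. -/
def M (k : ℕ) : Set (TstarQ E Q) := constraintSet (ICot E) (range (FL L)) OmegaQ (h₁ L) (k - 1)

/-- Around each point of `C ⊆ M₁` there is a smooth vector field tangent to `C` that solves
`i_Y Ω₁ = dh₁`. -/
def HasSmoothSolutions (C : Set (TstarQ E Q)) : Prop :=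
  ∀ y ∈ C, ∃ U ∈ 𝓝 y, ∃ Y : ∀ z : TstarQ E Q, TangentSpace (ICot E) z,
    ContMDiffOn (ICot E) (ICot E).tangent ∞
      (fun z => (⟨z, Y z⟩ : TangentBundle (ICot E) (TstarQ E Q))) (C ∩ U) ∧
    ∀ z ∈ C ∩ U, Y z ∈ tangentTo (ICot E) C z ∧
      Solves (ICot E) (range (FL L)) OmegaQ (h₁ L) z (Y z)

end SkinnerRusk

end

open SkinnerRusk

/-! In canonical coordinates, `i_X Ω = dD` at `(q, v, p)` reads `q̇ = v`, `p = ∂L/∂v`, `ṗ = ∂L/∂q`,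
with `v̇` free (`solves_whitney_iff`). On `M₁` every tangent vector is `TFL(U)` and `h₁ ∘ FL = E_L`
(`AlmostRegular.h₁_FL`), so the equation for `Y` at `FL(v)` becomes `Ω_Q(Y, TFL U) = dE_L(U)` for
all `U` (`solves_image_iff`). It holds whenever `q̇ = v` and `ṗ = ∂L/∂q`. Hence `Tpr₂` sends
solutions to solutions, and induction gives (i) and `pr₂(W_k) ⊆ M_k` (`mapsTo_pr₂_W`).

Conversely, a smooth solution `Y` along `M_f` suggests the lift `z ↦ (Tπ_Q(Y z), z)`. It must land
in the graph of `FL`: the vector `a = Tπ_Q(Y z)` has to lie in the fibre of `FL` over `z`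
(`Solves.FL_velocity`). Testing with vertical `U`, and using the symmetry of the Hessian, shows that
`a - u` is tangent to the fibre at every point `u` of it. The fibre is closed in `T_qQ`; at a point
`u` nearest to `a` the vector `a - u` is both tangent and orthogonal to the fibre, so it vanishes
(`mem_of_tangent_direction`).

Since `Y` is tangent to `M_f`, a curve in `M_f` with velocity `Y z` lifts to a curve whose velocity
solves the equation on `W₀`. By induction the lift lies in every `W_k` (`lift_mem_W`), so `M_f ⊆
pr₂(W_f)`. Finally (iii) follows from `pr = π_Q ∘ pr₂`. -/

noncomputable section

namespace SkinnerRusk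

/-! ### Bundle charts of `TQ`, `T^*Q` and `TQ ⊕ T^*Q` over a chart of `Q`. -/

section Coordinates
variable {E : Type*} [NormedAddCommGroup E] [NormedSpace ℝ E]
    {Q : Type*} [TopologicalSpace Q] [ChartedSpace E Q] [IsManifold 𝓘(ℝ, E) ∞ Q]

/-- The coordinates of tangent vectors at `q` in the preferred chart at `q₀`. -/
def vecCoord (q₀ q : Q) : TangentSpace 𝓘(ℝ, E) q →L[ℝ] E :=
  (trivializationAt E (TangentSpace 𝓘(ℝ, E)) q₀).continuousLinearMapAt ℝ q

/-- The tangent vector at `q` with given coordinates in the preferred chart at `q₀`. -/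
def vecOfCoord (q₀ q : Q) : E →L[ℝ] TangentSpace 𝓘(ℝ, E) q :=
  (trivializationAt E (TangentSpace 𝓘(ℝ, E)) q₀).symmL ℝ q

theorem vecCoord_vecOfCoord {q₀ q : Q} (hq : q ∈ (chartAt E q₀).source) (u : E) :
    vecCoord q₀ q (vecOfCoord q₀ q u) = u :=
  (trivializationAt E (TangentSpace 𝓘(ℝ, E)) q₀).continuousLinearMapAt_symmL hq u

theorem vecOfCoord_vecCoord {q₀ q : Q} (hq : q ∈ (chartAt E q₀).source)
    (v : TangentSpace 𝓘(ℝ, E) q) : vecOfCoord q₀ q (vecCoord q₀ q v) = v :=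
  (trivializationAt E (TangentSpace 𝓘(ℝ, E)) q₀).symmL_continuousLinearMapAt hq v

theorem vecCoord_self (q : Q) (v : TangentSpace 𝓘(ℝ, E) q) : vecCoord q q v = v := by
  rw [vecCoord, TangentBundle.continuousLinearMapAt_trivializationAt_eq_core (mem_chart_source E q)]
  exact (tangentBundleCore 𝓘(ℝ, E) Q).coordChange_self _ _ (mem_chart_source E q) v

theorem vecOfCoord_self (q : Q) (v : E) : vecOfCoord q q v = v := by
  rw [← vecCoord_self q (vecOfCoord q q v), vecCoord_vecOfCoord (mem_chart_source E q)]

/-- The preferred chart of `TQ` over the preferred chart of `Q` at `q₀`. -/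
def tanChart (q₀ : Q) : PartialEquiv (TQ E Q) (E × E) := extChartAt (ITan E) (⟨q₀, 0⟩ : TQ E Q)

/-- The preferred chart of `T^*Q` over the preferred chart of `Q` at `q₀`. -/
def cotChart (q₀ : Q) : PartialEquiv (TstarQ E Q) (E × (E →L[ℝ] ℝ)) :=
  extChartAt (ICot E) (⟨q₀, 0⟩ : TstarQ E Q)

/-- The preferred chart of `TQ ⊕ T^*Q` over the preferred chart of `Q` at `q₀`. -/
def whChart (q₀ : Q) : PartialEquiv (Whitney E Q) (E × (E × (E →L[ℝ] ℝ))) :=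
  extChartAt (IWh E) (⟨q₀, 0⟩ : Whitney E Q)

theorem extChartAt_tan (v : TQ E Q) : extChartAt (ITan E) v = tanChart v.proj := rfl
theorem extChartAt_cot (v : TstarQ E Q) : extChartAt (ICot E) v = cotChart v.proj := rfl
theorem extChartAt_wh (v : Whitney E Q) : extChartAt (IWh E) v = whChart v.proj := rfl

theorem tanChart_source (q₀ : Q) :
    (tanChart q₀ : PartialEquiv (TQ E Q) _).source = {v | v.proj ∈ (chartAt E q₀).source} := by
  ext v
  rw [tanChart, FiberBundle.extChartAt]
  simp

theorem cotChart_source (q₀ : Q) :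
    (cotChart q₀ : PartialEquiv (TstarQ E Q) _).source = {v | v.proj ∈ (chartAt E q₀).source} := by
  ext v
  rw [cotChart, FiberBundle.extChartAt]
  simp
  exact id

theorem whChart_source (q₀ : Q) :
    (whChart q₀ : PartialEquiv (Whitney E Q) _).source = {v | v.proj ∈ (chartAt E q₀).source} := by
  ext v
  rw [whChart, FiberBundle.extChartAt]
  simp
  exact id

theorem tanChart_target (q₀ : Q) :
    (tanChart q₀ : PartialEquiv (TQ E Q) (E × E)).target = (chartAt E q₀).target ×ˢ univ := by
  ext v
  rw [tanChart, FiberBundle.extChartAt_target]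
  simp
  intro h
  exact (chartAt E q₀).map_target h

theorem cotChart_target (q₀ : Q) :
    (cotChart q₀ : PartialEquiv (TstarQ E Q) _).target = (chartAt E q₀).target ×ˢ univ := by
  ext v
  rw [cotChart, FiberBundle.extChartAt_target]
  simp
  intro h
  exact (chartAt E q₀).map_target h

theorem whChart_target (q₀ : Q) :
    (whChart q₀ : PartialEquiv (Whitney E Q) _).target = (chartAt E q₀).target ×ˢ univ := by
  ext v
  rw [whChart, FiberBundle.extChartAt_target]
  simp
  intro h
  exact (chartAt E q₀).map_target h

theorem tanChart_apply {q₀ : Q} {v : TQ E Q} (hv : v.proj ∈ (chartAt E q₀).source) :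
    tanChart q₀ v = (chartAt E q₀ v.proj, vecCoord q₀ v.proj v.2) := by
  have := Trivialization.coe_linearMapAt_of_mem (R := ℝ)
    (trivializationAt E (TangentSpace 𝓘(ℝ, E)) q₀) hv
  rw [tanChart, FiberBundle.extChartAt]
  simp only [vecCoord, Trivialization.continuousLinearMapAt_apply, this]
  rfl

theorem cotChart_apply (q₀ : Q) (v : TstarQ E Q) :
    cotChart q₀ v = (chartAt E q₀ v.proj,
      ContinuousLinearMap.comp (v.2 : TangentSpace 𝓘(ℝ, E) v.proj →L[ℝ] ℝ)
        (vecOfCoord q₀ v.proj)) := by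
  rw [cotChart, FiberBundle.extChartAt]
  refine Prod.ext rfl ?_
  change ContinuousLinearMap.inCoordinates E (TangentSpace 𝓘(ℝ, E)) ℝ (fun _ : Q => ℝ)
    q₀ v.proj q₀ v.proj v.2 = _
  ext u
  simp [ContinuousLinearMap.inCoordinates, vecOfCoord]

theorem whChart_apply {q₀ : Q} {x : Whitney E Q} (hx : x.proj ∈ (chartAt E q₀).source) :
    whChart q₀ x = (chartAt E q₀ x.proj, (vecCoord q₀ x.proj x.2.1,
      ContinuousLinearMap.comp (x.2.2 : TangentSpace 𝓘(ℝ, E) x.proj →L[ℝ] ℝ)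
        (vecOfCoord q₀ x.proj))) := by
  have h1 : whChart q₀ x =
      ((tanChart q₀ (pr₁ x)).1, ((tanChart q₀ (pr₁ x)).2, (cotChart q₀ (pr₂ x)).2)) := by
    rw [whChart, FiberBundle.extChartAt, tanChart, FiberBundle.extChartAt, cotChart,
      FiberBundle.extChartAt]
    rfl
  rw [h1, tanChart_apply hx, cotChart_apply]
  rfl

theorem tanChart_symm_apply {q₀ : Q} {z : E × E} (hz : z.1 ∈ (chartAt E q₀).target) :
    (tanChart q₀).symm z =
      ⟨(chartAt E q₀).symm z.1, vecOfCoord q₀ ((chartAt E q₀).symm z.1) z.2⟩ := by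
  have hs := (chartAt E q₀).map_target hz
  have : z = tanChart q₀
      ⟨(chartAt E q₀).symm z.1, vecOfCoord q₀ ((chartAt E q₀).symm z.1) z.2⟩ := by
    rw [tanChart_apply hs]
    simp [vecCoord_vecOfCoord hs, (chartAt E q₀).right_inv hz]
  conv_lhs => rw [this]
  exact (tanChart q₀).left_inv (by rw [tanChart_source]; exact hs)

theorem cotChart_symm_apply {q₀ : Q} {z : E × (E →L[ℝ] ℝ)} (hz : z.1 ∈ (chartAt E q₀).target) :
    (cotChart q₀).symm z = ⟨(chartAt E q₀).symm z.1,
      z.2.comp (vecCoord q₀ ((chartAt E q₀).symm z.1))⟩ := by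
  have hs := (chartAt E q₀).map_target hz
  have : z = cotChart q₀ ⟨(chartAt E q₀).symm z.1,
      z.2.comp (vecCoord q₀ ((chartAt E q₀).symm z.1))⟩ := by
    rw [cotChart_apply]
    refine Prod.ext ((chartAt E q₀).right_inv hz).symm ?_
    ext u
    change _ = z.2 (vecCoord q₀ _ (vecOfCoord q₀ _ u))
    rw [vecCoord_vecOfCoord hs]
  conv_lhs => rw [this]
  exact (cotChart q₀).left_inv (by rw [cotChart_source]; exact hs)

theorem whChart_symm_apply {q₀ : Q} {z : E × (E × (E →L[ℝ] ℝ))} (hz : z.1 ∈ (chartAt E q₀).target) :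
    (whChart q₀).symm z = ⟨(chartAt E q₀).symm z.1,
      (vecOfCoord q₀ ((chartAt E q₀).symm z.1) z.2.1,
        z.2.2.comp (vecCoord q₀ ((chartAt E q₀).symm z.1)))⟩ := by
  have hs := (chartAt E q₀).map_target hz
  have : z = whChart q₀ ⟨(chartAt E q₀).symm z.1, (vecOfCoord q₀ ((chartAt E q₀).symm z.1) z.2.1,
      z.2.2.comp (vecCoord q₀ ((chartAt E q₀).symm z.1)))⟩ := by
    rw [whChart_apply hs]
    refine Prod.ext ((chartAt E q₀).right_inv hz).symm (Prod.ext ?_ ?_)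
    · exact (vecCoord_vecOfCoord hs _).symm
    ext u
    change _ = z.2.2 (vecCoord q₀ _ (vecOfCoord q₀ _ u))
    rw [vecCoord_vecOfCoord hs]
  conv_lhs => rw [this]
  exact (whChart q₀).left_inv (by rw [whChart_source]; exact hs)

end Coordinates

/-! ### Submersions and nearest points in finite-dimensional spaces. -/

section Flat
variable {A : Type*} [NormedAddCommGroup A] [NormedSpace ℝ A] [FiniteDimensional ℝ A]
  {V : Type*} [NormedAddCommGroup V] [NormedSpace ℝ V]

/-- Local inverse of a map with invertible derivative, smooth on a neighbourhood. -/
theorem exists_smooth_localInverse {f : A → V} {a : A}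
    (hf : ∀ᶠ b in 𝓝 a, ContDiffAt ℝ ∞ f b) (e : A ≃L[ℝ] V) (he : fderiv ℝ f a = e) :
    ∃ ψ : V → A, ψ (f a) = a ∧ (∀ᶠ y in 𝓝 (f a), ContDiffAt ℝ ∞ ψ y) ∧
      (∀ᶠ y in 𝓝 (f a), f (ψ y) = y) ∧ ∀ᶠ b in 𝓝 a, ψ (f b) = b := by
  have : CompleteSpace A := FiniteDimensional.complete ℝ A
  have h0 : ContDiffAt ℝ ∞ f a := hf.self_of_nhds
  have hn : (∞ : WithTop ℕ∞) ≠ 0 := by simp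
  have hd : HasFDerivAt f (e : A →L[ℝ] V) a := he ▸ (h0.differentiableAt hn).hasFDerivAt
  set φ := h0.toOpenPartialHomeomorph f hd hn with hφ
  have hcoe : (φ : A → V) = f := h0.toOpenPartialHomeomorph_coe hd hn
  have ha : a ∈ φ.source := h0.mem_toOpenPartialHomeomorph_source hd hn
  have hfa : f a ∈ φ.target := by rw [← hcoe]; exact φ.map_source ha
  have hinv : φ.symm (f a) = a := by rw [← hcoe]; exact φ.left_inv ha
  refine ⟨φ.symm, hinv, ?_, ?_, ?_⟩
  · have hc : ContinuousAt (fderiv ℝ f) a := (h0.fderiv_right (m := ∞) (by simp)).continuousAt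
    -- Invertibility is an open condition on the derivative, so the inverse is smooth at all points
    -- near `f a`, not only at `f a`.
    have h1 : ∀ᶠ b in 𝓝 a, fderiv ℝ f b ∈ range ((↑) : (A ≃L[ℝ] V) → A →L[ℝ] V) :=
      hc.eventually (by rw [he]; exact ContinuousLinearEquiv.nhds e)
    have h2 : Filter.Tendsto φ.symm (𝓝 (f a)) (𝓝 a) := by
      have := φ.continuousAt_symm hfa
      rwa [ContinuousAt, hinv] at this
    filter_upwards [h2.eventually h1, h2.eventually hf, φ.open_target.mem_nhds hfa]
      with y hy1 hy2 hy3
    obtain ⟨e', he'⟩ := hy1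
    exact φ.contDiffAt_symm hy3 (by rw [hcoe, he']; exact (hy2.differentiableAt hn).hasFDerivAt)
      (by rwa [hcoe])
  · filter_upwards [φ.open_target.mem_nhds hfa] with y hy
    rw [← hcoe]; exact φ.right_inv hy
  · filter_upwards [φ.open_source.mem_nhds ha] with b hb
    rw [← hcoe]; exact φ.left_inv hb

/-- Near a point where it is a submersion, a map is a projection in suitable coordinates. -/
theorem exists_submersion_coordinates {g : A → V} {a : A}
    (hg : ∀ᶠ b in 𝓝 a, ContDiffAt ℝ ∞ g b) (hs : Function.Surjective (fderiv ℝ g a)) :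
    ∃ (P : A →L[ℝ] (fderiv ℝ g a).ker) (ψ : V × (fderiv ℝ g a).ker → A),
      (∀ w : (fderiv ℝ g a).ker, P w = w) ∧
      ψ (g a, P a) = a ∧ (∀ᶠ z in 𝓝 (g a, P a), ContDiffAt ℝ ∞ ψ z) ∧
      (∀ᶠ z in 𝓝 (g a, P a), g (ψ z) = z.1 ∧ P (ψ z) = z.2) ∧
      ∀ᶠ b in 𝓝 a, ψ (g b, P b) = b := by
  obtain ⟨P, hP⟩ := Submodule.ClosedComplemented.of_finiteDimensional (fderiv ℝ g a).ker
  have hn : (∞ : WithTop ℕ∞) ≠ 0 := by simp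
  have hd : HasFDerivAt g (fderiv ℝ g a) a :=
    (hg.self_of_nhds.differentiableAt hn).hasFDerivAt
  have hd2 := hd.prodMk (P.hasFDerivAt (x := a))
  -- `P` restricts to the identity on the kernel of the derivative, so it supplies exactly the
  -- coordinates that the derivative loses.
  have hbij : Function.Bijective ((fderiv ℝ g a).prod P) := by
    constructor
    · rw [injective_iff_map_eq_zero]
      intro w hw
      have hw1 : fderiv ℝ g a w = 0 := congrArg Prod.fst hw
      have hw2 : P w = 0 := congrArg Prod.snd hw
      have := hP ⟨w, hw1⟩
      rw [hw2] at this
      exact (congrArg Subtype.val this).symm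
    · rintro ⟨y, k⟩
      obtain ⟨w, hw⟩ := hs y
      refine ⟨w + (k - P w : (fderiv ℝ g a).ker), Prod.ext ?_ ?_⟩
      · have : fderiv ℝ g a ((k - P w : (fderiv ℝ g a).ker) : A) = 0 := (k - P w).2
        simp only [ContinuousLinearMap.prod_apply, map_add, this, hw, Prod.mk_add_mk, add_zero]
      · simp only [ContinuousLinearMap.prod_apply, map_add, hP, Prod.snd_add]
        abel
  let e : A ≃L[ℝ] V × (fderiv ℝ g a).ker :=
    (LinearEquiv.ofBijective ((fderiv ℝ g a).prod P : A →ₗ[ℝ] V × (fderiv ℝ g a).ker)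
      hbij).toContinuousLinearEquiv
  obtain ⟨ψ, h1, h2, h3, h4⟩ := exists_smooth_localInverse (f := fun b => (g b, P b)) (a := a)
    (hg.mono fun b hb => hb.prodMk P.contDiff.contDiffAt) e (by rw [hd2.fderiv]; ext <;> rfl)
  exact ⟨P, ψ, hP, h1, h2, h3.mono fun z hz => ⟨congrArg Prod.fst hz, congrArg Prod.snd hz⟩, h4⟩

/-- The section freezes the kernel coordinate at `P a`. -/
theorem exists_local_section {g : A → V} {a : A}
    (hg : ∀ᶠ b in 𝓝 a, ContDiffAt ℝ ∞ g b) (hs : Function.Surjective (fderiv ℝ g a)) :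
    ∃ s : V → A, s (g a) = a ∧ (∀ᶠ y in 𝓝 (g a), ContDiffAt ℝ ∞ s y) ∧
      ∀ᶠ y in 𝓝 (g a), g (s y) = y := by
  obtain ⟨P, ψ, -, h1, h2, h3, -⟩ := exists_submersion_coordinates hg hs
  have hc : Filter.Tendsto (fun y : V => (y, P a)) (𝓝 (g a)) (𝓝 (g a, P a)) :=
    Continuous.tendsto (by fun_prop) _
  refine ⟨fun y => ψ (y, P a), h1, ?_, (hc.eventually h3).mono fun y hy => hy.1⟩
  filter_upwards [hc.eventually h2] with y hy
  exact hy.comp y (contDiffAt_id.prodMk contDiffAt_const)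

/-- Vectors in the kernel of the derivative of a submersion are velocities of curves in the
fibre. -/
theorem exists_curve_in_fibre {g : A → V} {a : A}
    (hg : ∀ᶠ b in 𝓝 a, ContDiffAt ℝ ∞ g b) (hs : Function.Surjective (fderiv ℝ g a))
    {w : A} (hw : fderiv ℝ g a w = 0) :
    ∃ c : ℝ → A, c 0 = a ∧ HasDerivAt c w 0 ∧ ∀ᶠ t in 𝓝 (0 : ℝ), g (c t) = g a := by
  obtain ⟨P, ψ, hP, h1, h2, h3, h4⟩ := exists_submersion_coordinates hg hs
  have hn : (∞ : WithTop ℕ∞) ≠ 0 := by simp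
  have hd : HasFDerivAt g (fderiv ℝ g a) a :=
    (hg.self_of_nhds.differentiableAt hn).hasFDerivAt
  have hd2 := hd.prodMk (P.hasFDerivAt (x := a))
  have hψ : HasFDerivAt ψ (fderiv ℝ ψ (g a, P a)) (g a, P a) :=
    (h2.self_of_nhds.differentiableAt hn).hasFDerivAt
  -- Differentiating `ψ ∘ (g, P) = id` in the direction `w` gives `Dψ (0, P w) = w`: the line `P a +
  -- t P w` in the fibre coordinate has the right velocity.
  have hid : HasFDerivAt (fun b => b) ((fderiv ℝ ψ (g a, P a)).comp ((fderiv ℝ g a).prod P)) a :=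
    (HasFDerivAt.comp a hψ hd2).congr_of_eventuallyEq (h4.mono fun b hb => hb.symm)
  have hid2 := congrArg (fun l => l w) (hid.unique (hasFDerivAt_id a))
  simp only [ContinuousLinearMap.comp_apply, ContinuousLinearMap.prod_apply, hw,
    ContinuousLinearMap.coe_id', id] at hid2
  have hl : HasDerivAt (fun t : ℝ => (g a, P a + t • P w)) ((0 : V), P w) 0 := by
    refine HasDerivAt.prodMk (hasDerivAt_const _ _) ?_
    simpa using ((hasDerivAt_id (0 : ℝ)).smul_const (P w)).const_add (P a)
  have h0 : (fun t : ℝ => (g a, P a + t • P w)) 0 = (g a, P a) := by simp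
  refine ⟨fun t => ψ (g a, P a + t • P w), by simpa using h1, ?_, ?_⟩
  · rw [← h0] at hψ
    have := hψ.comp_hasDerivAt (0 : ℝ) hl
    rw [h0, hid2] at this
    exact this
  · have := hl.continuousAt
    simp only [ContinuousAt, zero_smul, add_zero] at this
    exact (this.eventually h3).mono fun t ht => ht.1

/-- A function whose derivative vanishes on the kernels of the derivatives of a submersion is
locally constant on the fibres. -/
theorem eventually_eq_on_fibre {g : A → V} {a : A}
    (hg : ∀ᶠ b in 𝓝 a, ContDiffAt ℝ ∞ g b) (hs : Function.Surjective (fderiv ℝ g a))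
    {h : A → ℝ} (hh : ∀ᶠ b in 𝓝 a, DifferentiableAt ℝ h b ∧
      ∀ w, fderiv ℝ g b w = 0 → fderiv ℝ h b w = 0) :
    ∀ᶠ b in 𝓝 a, g b = g a → h b = h a := by
  obtain ⟨P, ψ, hP, h1, h2, h3, h4⟩ := exists_submersion_coordinates hg hs
  have hn : (∞ : WithTop ℕ∞) ≠ 0 := by simp
  have hi : Filter.Tendsto (fun k => (g a, k)) (𝓝 (P a)) (𝓝 (g a, P a)) :=
    Continuous.tendsto (by fun_prop) _
  have hψc : Filter.Tendsto ψ (𝓝 (g a, P a)) (𝓝 a) := by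
    have := h2.self_of_nhds.continuousAt
    rwa [ContinuousAt, h1] at this
  -- In the slice over `g a` the map `g ∘ ψ` is constant, so directions in the slice are carried
  -- into kernels of `Dg`, where `Dh` vanishes.
  have key : ∀ᶠ k in 𝓝 (P a), HasFDerivAt (fun k => h (ψ (g a, k)))
      (0 : (fderiv ℝ g a).ker →L[ℝ] ℝ) k := by
    filter_upwards [hi.eventually h2, hi.eventually h3.eventually_nhds,
      (hψc.comp hi).eventually hh, (hψc.comp hi).eventually hg] with k k2 k3 k4 k5
    have hin : HasFDerivAt (fun k : (fderiv ℝ g a).ker => (g a, k))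
        (ContinuousLinearMap.inr ℝ V (fderiv ℝ g a).ker) k :=
      (hasFDerivAt_const _ _).prodMk (hasFDerivAt_id k)
    have d1 := (k2.differentiableAt hn).hasFDerivAt.comp k hin
    have d2 := k4.1.hasFDerivAt.comp k d1
    have d3 := (k5.differentiableAt hn).hasFDerivAt.comp k d1
    have hin' : Filter.Tendsto (fun k => (g a, k)) (𝓝 k) (𝓝 (g a, k)) :=
      Continuous.tendsto (by fun_prop) _
    have d4 := (hasFDerivAt_const (𝕜 := ℝ) (E := (fderiv ℝ g a).ker) (g a)
      k).congr_of_eventuallyEq (f₁ := g ∘ ψ ∘ fun k => (g a, k))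
      ((hin'.eventually k3).mono fun k' hk' => hk'.1)
    refine d2.congr_fderiv (ContinuousLinearMap.ext fun w => ?_)
    exact k4.2 _ (congrArg (fun l => l w) (d3.unique d4))
  obtain ⟨ε, hε, hball⟩ := Metric.eventually_nhds_iff_ball.1 key
  have hconst : ∀ k ∈ Metric.ball (P a) ε, h (ψ (g a, k)) = h (ψ (g a, P a)) := by
    intro k hk
    exact (convex_ball (P a) ε).is_const_of_fderivWithin_eq_zero (𝕜 := ℝ)
      (fun k hk => (hball k hk).differentiableAt.differentiableWithinAt)
      (fun k hk => by
        rw [fderivWithin_of_isOpen Metric.isOpen_ball hk, (hball k hk).fderiv]) hk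
      (Metric.mem_ball_self hε)
  filter_upwards [h4, P.continuous.continuousAt.eventually (Metric.ball_mem_nhds (P a) hε)]
    with b hb1 hb2 hb3
  have := hconst _ hb2
  rwa [← hb3, hb1, hb3, h1] at this

/-- If `F` is closed and nonempty, and at each point `u` of `F` the vector `v - u` is the velocity
of a curve in `F`, then `v ∈ F`: the point of `F` nearest to `v` is `v`. -/
theorem mem_of_tangent_direction {F : Set A} (hF : IsClosed F) (hne : F.Nonempty) (v : A)
    (hc : ∀ u ∈ F, ∃ c : ℝ → A, c 0 = u ∧ HasDerivAt c (v - u) 0 ∧ ∀ᶠ t in 𝓝 (0 : ℝ), c t ∈ F) :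
    v ∈ F := by
  -- The norm of `A` need not come from an inner product; a Euclidean norm makes "nearest" mean
  -- "orthogonal".
  let e := toEuclidean (E := A)
  obtain ⟨y, hy, hmin⟩ := (hF.preimage e.symm.continuous).exists_infDist_eq_dist
    (by obtain ⟨u, hu⟩ := hne; exact ⟨e u, by simpa using hu⟩) (e v)
  obtain ⟨c, hc0, hcd, hcF⟩ := hc (e.symm y) hy
  have hd : HasDerivAt (fun t => e v - e (c t)) (-(e v - y)) 0 := by
    have := (e.toContinuousLinearMap.hasFDerivAt.comp_hasDerivAt (0 : ℝ) hcd).const_sub (e v)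
    simpa using this
  -- The squared distance along `c` has derivative `-2 ‖e v - y‖²` at `0`, which must vanish at a
  -- minimum.
  have hq := hd.norm_sq
  have hlm : IsLocalMin (fun t => ‖e v - e (c t)‖ ^ 2) 0 := by
    filter_upwards [hcF] with t ht
    have h1 := Metric.infDist_le_dist_of_mem (x := e v)
      (show e (c t) ∈ e.symm ⁻¹' F by simpa using ht)
    rw [hmin, dist_eq_norm, dist_eq_norm] at h1
    simp only [hc0, ContinuousLinearEquiv.apply_symm_apply]
    gcongr
  have h0 := hlm.hasDerivAt_eq_zero hq
  simp only [hc0, ContinuousLinearEquiv.apply_symm_apply, inner_neg_right,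
    real_inner_self_eq_norm_sq] at h0
  have h2 : ‖e v - y‖ = 0 := by
    have : ‖e v - y‖ ^ 2 = 0 := by linarith
    exact pow_eq_zero_iff (two_ne_zero) |>.1 this
  have h3 : e v = y := sub_eq_zero.1 (norm_eq_zero.1 h2)
  rw [← h3] at hy
  simpa using hy

end Flat

/-! ### Velocities of curves and derivatives, read in charts. -/

section Curves
variable {F : Type*} [NormedAddCommGroup F] [NormedSpace ℝ F]
  {H : Type*} [TopologicalSpace H] {I : ModelWithCorners ℝ F H}
  {N : Type*} [TopologicalSpace N] [ChartedSpace H N]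
  {F' : Type*} [NormedAddCommGroup F'] [NormedSpace ℝ F']
  {H' : Type*} [TopologicalSpace H'] {I' : ModelWithCorners ℝ F' H'}
  {N' : Type*} [TopologicalSpace N'] [ChartedSpace H' N']

theorem IsCurveIn.apply_zero {S : Set N} {x : N} {Z : TangentSpace I x} {γ : ℝ → N}
    (h : IsCurveIn I S x Z γ) : γ 0 = x := congrArg TotalSpace.proj h.2

theorem IsCurveIn.eventually_mem {S : Set N} {x : N} {Z : TangentSpace I x} {γ : ℝ → N}
    (h : IsCurveIn I S x Z γ) : ∀ᶠ t in 𝓝 (0 : ℝ), γ t ∈ S := by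
  obtain ⟨⟨ε, hε, -, h2⟩, -⟩ := h
  filter_upwards [Ioo_mem_nhds (neg_lt_zero.2 hε) hε] with t ht using h2 t ht

theorem IsCurveIn.eventually_contMDiffAt {S : Set N} {x : N} {Z : TangentSpace I x} {γ : ℝ → N}
    (h : IsCurveIn I S x Z γ) : ∀ᶠ t in 𝓝 (0 : ℝ), ContMDiffAt 𝓘(ℝ, ℝ) I ∞ γ t := by
  obtain ⟨⟨ε, hε, h1, -⟩, -⟩ := h
  filter_upwards [Ioo_mem_nhds (neg_lt_zero.2 hε) hε] with t ht
  exact h1.contMDiffAt (isOpen_Ioo.mem_nhds ht)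

theorem IsCurveIn.mdifferentiableAt {S : Set N} {x : N} {Z : TangentSpace I x} {γ : ℝ → N}
    (h : IsCurveIn I S x Z γ) :
    MDifferentiableAt 𝓘(ℝ, ℝ) I γ 0 :=
  h.eventually_contMDiffAt.self_of_nhds.mdifferentiableAt (by simp)

theorem isCurveIn_of_mfderiv {S : Set N} {γ : ℝ → N} (h1 : ∀ᶠ t in 𝓝 (0 : ℝ), γ t ∈ S)
    (h2 : ∀ᶠ t in 𝓝 (0 : ℝ), ContMDiffAt 𝓘(ℝ, ℝ) I ∞ γ t) :
    IsCurveIn I S (γ 0) (mfderiv 𝓘(ℝ, ℝ) I γ 0 (1 : ℝ)) γ := by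
  obtain ⟨ε, hε, hb⟩ := Metric.eventually_nhds_iff_ball.1 (h1.and h2)
  rw [Real.ball_eq_Ioo, zero_sub, zero_add] at hb
  exact ⟨⟨ε, hε, fun t ht => (hb t ht).2.contMDiffWithinAt, fun t ht => (hb t ht).1⟩, rfl⟩

/-- The tangent space at a point is the model space seen through the preferred chart there, so
manifold velocities are ordinary derivatives of chart expressions. -/
theorem hasDerivAt_of_mdifferentiableAt {γ : ℝ → N} (h : MDifferentiableAt 𝓘(ℝ, ℝ) I γ 0) :
    HasDerivAt (extChartAt I (γ 0) ∘ γ) (mfderiv 𝓘(ℝ, ℝ) I γ 0 (1 : ℝ) : F) 0 := by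
  have key : ∀ l : ℝ →L[ℝ] F, HasFDerivWithinAt (extChartAt I (γ 0) ∘ γ) l univ 0 →
      HasDerivAt (extChartAt I (γ 0) ∘ γ) (l 1) 0 := fun l hl =>
    (hasFDerivWithinAt_univ.1 hl).hasDerivAt
  have h2 := h.hasMFDerivAt.2
  rw [ModelWithCorners.range_eq_univ] at h2
  exact key _ h2

theorem mfderiv_eq_of_hasDerivAt {γ : ℝ → N} {Z : TangentSpace I (γ 0)} (hc : ContinuousAt γ 0)
    (h : HasDerivAt (extChartAt I (γ 0) ∘ γ) (Z : F) 0) :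
    mfderiv 𝓘(ℝ, ℝ) I γ 0 (1 : ℝ) = Z := by
  have h1 : HasMFDerivAt 𝓘(ℝ, ℝ) I γ 0 (ContinuousLinearMap.toSpanSingleton ℝ (Z : F)) :=
    ⟨hc, h.hasFDerivAt.hasFDerivWithinAt⟩
  rw [h1.mfderiv]
  exact one_smul ℝ (Z : F)

theorem IsCurveIn.hasDerivAt {S : Set N} {x : N} {Z : TangentSpace I x} {γ : ℝ → N}
    (h : IsCurveIn I S x Z γ) : HasDerivAt (extChartAt I x ∘ γ) (Z : F) 0 := by
  have h0 := h.apply_zero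
  subst h0
  have h2 : mfderiv 𝓘(ℝ, ℝ) I γ 0 (1 : ℝ) = Z :=
    eq_of_heq (TotalSpace.mk.inj h.2).2
  rw [← h2]
  exact hasDerivAt_of_mdifferentiableAt h.mdifferentiableAt

theorem isCurveIn_of_hasDerivAt {S : Set N} {γ : ℝ → N} {x : N} {Z : TangentSpace I x}
    (h0 : γ 0 = x) (h1 : ∀ᶠ t in 𝓝 (0 : ℝ), γ t ∈ S)
    (h2 : ∀ᶠ t in 𝓝 (0 : ℝ), ContMDiffAt 𝓘(ℝ, ℝ) I ∞ γ t)
    (h3 : HasDerivAt (extChartAt I x ∘ γ) (Z : F) 0) : IsCurveIn I S x Z γ := by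
  subst h0
  rw [← mfderiv_eq_of_hasDerivAt h2.self_of_nhds.continuousAt h3]
  exact isCurveIn_of_mfderiv h1 h2

theorem IsCurveIn.map {S : Set N} {S' : Set N'} {x : N} {Z : TangentSpace I x} {γ : ℝ → N}
    (h : IsCurveIn I S x Z γ) {f : N → N'} (hf : ContMDiff I I' ∞ f) (hS : MapsTo f S S') :
    IsCurveIn I' S' (f x) (mfderiv I I' f x Z) (f ∘ γ) := by
  refine ⟨?_, ?_⟩
  · obtain ⟨⟨ε, hε, h1, h2⟩, -⟩ := h
    exact ⟨ε, hε, hf.comp_contMDiffOn h1, fun t ht => hS (h2 t ht)⟩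
  · have h0 := h.apply_zero
    subst h0
    rw [tangentMap_comp_at _ (hf.mdifferentiable (by simp) _) h.mdifferentiableAt, h.2]
    rfl

theorem tangentTo_map {S : Set N} {S' : Set N'} {x : N} {Z : TangentSpace I x}
    (h : Z ∈ tangentTo I S x) {f : N → N'} (hf : ContMDiff I I' ∞ f) (hS : MapsTo f S S') :
    mfderiv I I' f x Z ∈ tangentTo I' S' (f x) := by
  obtain ⟨γ, hγ⟩ := h
  exact ⟨f ∘ γ, hγ.map hf hS⟩

/-- The derivative of a map, computed in the preferred charts. -/
theorem hasMFDerivAt_of_coordinates {f : N → N'} {x : N} (hc : ContinuousAt f x) {f' : F →L[ℝ] F'}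
    (h : HasFDerivAt (extChartAt I' (f x) ∘ f ∘ (extChartAt I x).symm) f' (extChartAt I x x)) :
    HasMFDerivAt I I' f x f' := ⟨hc, h.hasFDerivWithinAt⟩

variable [I.Boundaryless]

/-- The curve through `x` given by a smooth curve in a chart. -/
theorem isCurveIn_chart [IsManifold I ∞ N] {S : Set N} {x : N} {Z : TangentSpace I x} {c : ℝ → F}
    (h0 : c 0 = extChartAt I x x) (hc : ∀ᶠ t in 𝓝 (0 : ℝ), ContDiffAt ℝ ∞ c t)
    (hZ : HasDerivAt c (Z : F) 0) (hS : ∀ᶠ t in 𝓝 (0 : ℝ), (extChartAt I x).symm (c t) ∈ S) :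
    IsCurveIn I S x Z ((extChartAt I x).symm ∘ c) := by
  have ht : ∀ᶠ t in 𝓝 (0 : ℝ), c t ∈ (extChartAt I x).target := by
    refine hZ.continuousAt.eventually ?_
    rw [h0]
    exact extChartAt_target_mem_nhds x
  refine isCurveIn_of_hasDerivAt (by simp [h0]) hS ?_ ?_
  · filter_upwards [hc, ht] with t ht1 ht2
    refine ContMDiffAt.comp t ?_ ht1.contMDiffAt
    exact (contMDiffOn_extChartAt_symm x).contMDiffAt ((isOpen_extChartAt_target x).mem_nhds ht2)
  · refine hZ.congr_of_eventuallyEq ?_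
    filter_upwards [ht] with t ht
    exact (extChartAt I x).right_inv ht

end Curves

/-! ### The projections, the Liouville form and `Ω_Q` in canonical coordinates. -/

section CoordinatesII
variable {E : Type*} [NormedAddCommGroup E] [NormedSpace ℝ E]
    {Q : Type*} [TopologicalSpace Q] [ChartedSpace E Q] [IsManifold 𝓘(ℝ, E) ∞ Q]

theorem contMDiff_piQ : ContMDiff (ICot E) 𝓘(ℝ, E) ∞ (piQ : TstarQ E Q → Q) :=
  Bundle.contMDiff_proj _

theorem contMDiff_pr₂ : ContMDiff (IWh E) (ICot E) ∞ (pr₂ : Whitney E Q → TstarQ E Q) := by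
  intro x
  rw [contMDiffAt_totalSpace]
  refine ⟨Bundle.contMDiffAt_proj _, ?_⟩
  have h := (contMDiffAt_totalSpace (f := fun y : Whitney E Q => y) (x₀ := x)
    (n := ∞) (IM := IWh E) (IB := 𝓘(ℝ, E))).1 contMDiffAt_id
  exact ((ContinuousLinearMap.snd ℝ E (E →L[ℝ] ℝ)).contMDiff.contMDiffAt).comp x h.2

theorem contMDiffWithinAt_whitney {F : Type*} [NormedAddCommGroup F] [NormedSpace ℝ F]
    {H : Type*} [TopologicalSpace H] {I : ModelWithCorners ℝ F H}
    {N : Type*} [TopologicalSpace N] [ChartedSpace H N] {f : N → Whitney E Q} {s : Set N} {z : N}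
    (h1 : ContMDiffWithinAt I (ITan E) ∞ (pr₁ ∘ f) s z)
    (h2 : ContMDiffWithinAt I (ICot E) ∞ (pr₂ ∘ f) s z) :
    ContMDiffWithinAt I (IWh E) ∞ f s z := by
  rw [contMDiffWithinAt_totalSpace] at h1 h2 ⊢
  exact ⟨h1.1, h1.2.prodMk_space h2.2⟩

theorem mem_target_iff_tan {q₀ : Q} {z : E × E} :
    z ∈ (tanChart q₀ : PartialEquiv (TQ E Q) (E × E)).target ↔ z.1 ∈ (chartAt E q₀).target := by
  rw [tanChart_target]; simp

theorem mem_target_iff_cot {q₀ : Q} {z : E × (E →L[ℝ] ℝ)} :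
    z ∈ (cotChart q₀ : PartialEquiv (TstarQ E Q) _).target ↔ z.1 ∈ (chartAt E q₀).target := by
  rw [cotChart_target]; simp

theorem mem_target_iff_wh {q₀ : Q} {z : E × (E × (E →L[ℝ] ℝ))} :
    z ∈ (whChart q₀ : PartialEquiv (Whitney E Q) _).target ↔ z.1 ∈ (chartAt E q₀).target := by
  rw [whChart_target]; simp

theorem tanChart_self (v : TQ E Q) : tanChart v.proj v = (chartAt E v.proj v.proj, v.2) := by
  rw [tanChart_apply (mem_chart_source E v.proj), vecCoord_self]
  rfl

theorem cotChart_self (α : TstarQ E Q) : cotChart α.proj α = (chartAt E α.proj α.proj, α.2) := by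
  rw [cotChart_apply]
  refine Prod.ext rfl ?_
  ext u
  exact congrArg α.2 (vecOfCoord_self _ u)

theorem whChart_self (x : Whitney E Q) : whChart x.proj x = (chartAt E x.proj x.proj, x.2) := by
  rw [whChart_apply (mem_chart_source E x.proj), vecCoord_self]
  refine Prod.ext rfl (Prod.ext rfl ?_)
  ext u
  exact congrArg x.2.2 (vecOfCoord_self _ u)

theorem cotChart_pairing {q₀ : Q} {α : TstarQ E Q} (hα : α.proj ∈ (chartAt E q₀).source)
    (w : TangentSpace 𝓘(ℝ, E) α.proj) : (cotChart q₀ α).2 (vecCoord q₀ α.proj w) = α.2 w := by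
  rw [cotChart_apply]
  exact congrArg α.2 (vecOfCoord_vecCoord hα w)

theorem chartAt_proj_cotChart_symm {q₀ : Q} {z : E × (E →L[ℝ] ℝ)}
    (hz : z.1 ∈ (chartAt E q₀).target) :
    chartAt E q₀ (piQ ((cotChart q₀).symm z : TstarQ E Q)) = z.1 := by
  rw [cotChart_symm_apply hz]
  exact (chartAt E q₀).right_inv hz

theorem mfderiv_piQ (α : TstarQ E Q) (X : TangentSpace (ICot E) α) :
    mfderiv (ICot E) 𝓘(ℝ, E) (piQ : TstarQ E Q → Q) α X = (X : E × (E →L[ℝ] ℝ)).1 := by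
  have h : HasMFDerivAt (ICot E) 𝓘(ℝ, E) (piQ : TstarQ E Q → Q) α
      (ContinuousLinearMap.fst ℝ E (E →L[ℝ] ℝ)) := by
    refine hasMFDerivAt_of_coordinates (contMDiff_piQ.continuous.continuousAt) ?_
    refine (ContinuousLinearMap.fst ℝ E (E →L[ℝ] ℝ)).hasFDerivAt.congr_of_eventuallyEq ?_
    filter_upwards [extChartAt_target_mem_nhds (I := ICot E) α] with z hz
    exact chartAt_proj_cotChart_symm (mem_target_iff_cot.1 hz)
  rw [h.mfderiv]
  rfl

theorem mfderiv_pr₂ (x : Whitney E Q) (X : TangentSpace (IWh E) x) :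
    mfderiv (IWh E) (ICot E) (pr₂ : Whitney E Q → TstarQ E Q) x X =
      ((X : E × (E × (E →L[ℝ] ℝ))).1, (X : E × (E × (E →L[ℝ] ℝ))).2.2) := by
  have h : HasMFDerivAt (IWh E) (ICot E) (pr₂ : Whitney E Q → TstarQ E Q) x
      ((ContinuousLinearMap.fst ℝ E (E × (E →L[ℝ] ℝ))).prod
        ((ContinuousLinearMap.snd ℝ E (E →L[ℝ] ℝ)).comp
          (ContinuousLinearMap.snd ℝ E (E × (E →L[ℝ] ℝ))))) := by
    refine hasMFDerivAt_of_coordinates (contMDiff_pr₂.continuous.continuousAt) ?_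
    refine (ContinuousLinearMap.hasFDerivAt _).congr_of_eventuallyEq ?_
    filter_upwards [extChartAt_target_mem_nhds (I := IWh E) x] with z hz'
    have hz := mem_target_iff_wh.1 hz'
    have : pr₂ ((whChart x.proj).symm z) = (cotChart x.proj).symm (z.1, z.2.2) := by
      rw [whChart_symm_apply hz, cotChart_symm_apply hz]; rfl
    exact (congrArg (cotChart x.proj) this).trans
      ((cotChart x.proj).right_inv (mem_target_iff_cot.2 hz))
  rw [h.mfderiv]
  rfl

theorem mfderiv_extChartAt_self {F : Type*} [NormedAddCommGroup F] [NormedSpace ℝ F]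
    {H : Type*} [TopologicalSpace H] {I : ModelWithCorners ℝ F H} [I.Boundaryless]
    {N : Type*} [TopologicalSpace N] [ChartedSpace H N] (x : N) (Z : TangentSpace I x) :
    mfderiv I 𝓘(ℝ, F) (extChartAt I x) x Z = (Z : F) := by
  have h : HasMFDerivAt I 𝓘(ℝ, F) (extChartAt I x) x (ContinuousLinearMap.id ℝ F) := by
    refine hasMFDerivAt_of_coordinates (continuousAt_extChartAt x) ?_
    refine (hasFDerivAt_id _).congr_of_eventuallyEq ?_
    filter_upwards [extChartAt_target_mem_nhds (I := I) x] with z hz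
    simp only [Function.comp_apply, (extChartAt I x).right_inv hz, extChartAt_model_space_eq_id]
    rfl
  rw [h.mfderiv]
  rfl

/-- This is `θ = p dq`. The pairing may be computed in the coordinates at `q₀`, and there `π_Q`
becomes the first projection. -/
theorem liouvilleForm_in_chart {q₀ : Q} {z : E × (E →L[ℝ] ℝ)}
    (hz : z.1 ∈ (chartAt E q₀).target) (ζ : E × (E →L[ℝ] ℝ)) :
    liouvilleForm ((cotChart q₀).symm z : TstarQ E Q)
      (mfderiv 𝓘(ℝ, E × (E →L[ℝ] ℝ)) (ICot E) (cotChart q₀).symm z ζ) = z.2 ζ.1 := by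
  set α : TstarQ E Q := (cotChart q₀).symm z with hα
  have hzt : z ∈ (cotChart q₀ : PartialEquiv (TstarQ E Q) _).target := mem_target_iff_cot.2 hz
  have hs : α.proj ∈ (chartAt E q₀).source := by
    have := (cotChart q₀).map_target hzt
    rwa [cotChart_source] at this
  have hcz : cotChart q₀ α = z := (cotChart q₀).right_inv hzt
  change α.2 (mfderiv (ICot E) 𝓘(ℝ, E) (piQ : TstarQ E Q → Q) α _) = _
  refine (cotChart_pairing hs _).symm.trans ?_
  rw [hcz, vecCoord, TangentBundle.continuousLinearMapAt_trivializationAt hs]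
  refine congrArg z.2 ?_
  have d1 : MDifferentiableAt 𝓘(ℝ, E × (E →L[ℝ] ℝ)) (ICot E)
      ((cotChart q₀).symm : _ → TstarQ E Q) z :=
    ((contMDiffOn_extChartAt_symm (n := ∞) (⟨q₀, 0⟩ : TstarQ E Q)).contMDiffAt
      ((isOpen_extChartAt_target _).mem_nhds hzt)).mdifferentiableAt (by simp)
  have d2 : MDifferentiableAt (ICot E) 𝓘(ℝ, E) (piQ : TstarQ E Q → Q) α :=
    contMDiff_piQ.mdifferentiable (by simp) α
  have d3 : MDifferentiableAt 𝓘(ℝ, E) 𝓘(ℝ, E) (extChartAt 𝓘(ℝ, E) q₀) α.proj :=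
    (contMDiffAt_extChartAt' (n := ∞) hs).mdifferentiableAt (by simp)
  have d4 := (d3.hasMFDerivAt.comp α d2.hasMFDerivAt).comp z d1.hasMFDerivAt
  have d5 : HasMFDerivAt 𝓘(ℝ, E × (E →L[ℝ] ℝ)) 𝓘(ℝ, E)
      ((extChartAt 𝓘(ℝ, E) q₀ ∘ (piQ : TstarQ E Q → Q)) ∘ (cotChart q₀).symm) z
      (ContinuousLinearMap.fst ℝ E (E →L[ℝ] ℝ)) := by
    refine HasFDerivAt.hasMFDerivAt ?_
    refine (ContinuousLinearMap.fst ℝ E (E →L[ℝ] ℝ)).hasFDerivAt.congr_of_eventuallyEq ?_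
    filter_upwards [continuous_fst.continuousAt.eventually ((chartAt E q₀).open_target.mem_nhds hz)]
      with w hw
    exact chartAt_proj_cotChart_symm hw
  exact congrArg (fun l => l ζ) (hasMFDerivAt_unique d4 d5)

/-- The local representative of `p dq` depends linearly on the point, hence is its own derivative;
antisymmetrizing gives `dq ∧ dp`. -/
theorem OmegaQ_eq (α : TstarQ E Q) (X Z : TangentSpace (ICot E) α) :
    OmegaQ α X Z = (Z : E × (E →L[ℝ] ℝ)).2 (X : E × (E →L[ℝ] ℝ)).1 -
      (X : E × (E →L[ℝ] ℝ)).2 (Z : E × (E →L[ℝ] ℝ)).1 := by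
  have key : ∀ θ : E × (E →L[ℝ] ℝ) → (E × (E →L[ℝ] ℝ)) →L[ℝ] ℝ, ∀ z₀ : E × (E →L[ℝ] ℝ),
      (∀ᶠ z in 𝓝 z₀, ∀ ζ, θ z ζ = z.2 ζ.1) → ∀ v w, fderiv ℝ θ z₀ v w = v.2 w.1 := by
    intro θ z₀ h v w
    let l := ((ContinuousLinearMap.compL ℝ (E × (E →L[ℝ] ℝ)) E ℝ).flip
      (ContinuousLinearMap.fst ℝ E (E →L[ℝ] ℝ))).comp (ContinuousLinearMap.snd ℝ E (E →L[ℝ] ℝ))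
    have h2 : θ =ᶠ[𝓝 z₀] l := h.mono fun z hz => ContinuousLinearMap.ext fun ζ => hz ζ
    rw [(l.hasFDerivAt.congr_of_eventuallyEq h2).fderiv]
    rfl
  have h1 := key (fun z => (liouvilleForm ((extChartAt (ICot E) α).symm z)).comp
    (mfderiv 𝓘(ℝ, E × (E →L[ℝ] ℝ)) (ICot E) (extChartAt (ICot E) α).symm z))
    (extChartAt (ICot E) α α) (by
      filter_upwards [extChartAt_target_mem_nhds (I := ICot E) α] with z hz ζ
      exact liouvilleForm_in_chart (mem_target_iff_cot.1 hz) ζ)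
  unfold OmegaQ extDerivOneForm
  simp only [mfderiv_extChartAt_self]
  refine (congrArg Neg.neg (congrArg₂ (· - ·) (h1 X Z) (h1 Z X))).trans ?_
  exact neg_sub _ _

/-- The `v`-components do not occur: this degeneracy of `Ω` forces the constraint `p = ∂L/∂v` and
leaves `v̇` undetermined. -/
theorem Omega_eq (x : Whitney E Q) (X Z : TangentSpace (IWh E) x) :
    Omega x X Z = (Z : E × (E × (E →L[ℝ] ℝ))).2.2 (X : E × (E × (E →L[ℝ] ℝ))).1 -
      (X : E × (E × (E →L[ℝ] ℝ))).2.2 (Z : E × (E × (E →L[ℝ] ℝ))).1 := by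
  rw [Omega, OmegaQ_eq, mfderiv_pr₂, mfderiv_pr₂]

end CoordinatesII

/-! ### The Legendre transformation, the energy and `D` in coordinates. -/

section Lagrangian
variable {E : Type*} [NormedAddCommGroup E] [NormedSpace ℝ E]
    {Q : Type*} [TopologicalSpace Q] [ChartedSpace E Q] [IsManifold 𝓘(ℝ, E) ∞ Q]
    (L : TQ E Q → ℝ)

/-- The Lagrangian in the preferred chart at `q₀`. -/
def lagrLoc (q₀ : Q) (z : E × E) : ℝ := L ((tanChart q₀).symm z)

/-- The Legendre transformation in the preferred chart at `q₀`. -/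
def legLoc (q₀ : Q) (z : E × E) : E × (E →L[ℝ] ℝ) :=
  (z.1, (fderiv ℝ (lagrLoc L q₀) z).comp (ContinuousLinearMap.inr ℝ E E))

variable {L}

theorem contDiffAt_lagrLoc (hL : ContMDiff (ITan E) 𝓘(ℝ, ℝ) ∞ L) {q₀ : Q} {z : E × E}
    (hz : z.1 ∈ (chartAt E q₀).target) : ContDiffAt ℝ ∞ (lagrLoc L q₀) z := by
  rw [← contMDiffAt_iff_contDiffAt]
  exact (hL _).comp z ((contMDiffOn_extChartAt_symm (⟨q₀, 0⟩ : TQ E Q)).contMDiffAt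
      ((isOpen_extChartAt_target _).mem_nhds (mem_target_iff_tan.2 hz)))

theorem contDiffAt_legLoc (hL : ContMDiff (ITan E) 𝓘(ℝ, ℝ) ∞ L) {q₀ : Q} {z : E × E}
    (hz : z.1 ∈ (chartAt E q₀).target) : ContDiffAt ℝ ∞ (legLoc L q₀) z := by
  have h := (contDiffAt_lagrLoc hL hz).fderiv_right (m := ∞) (by simp)
  exact contDiffAt_fst.prodMk (h.clm_comp contDiffAt_const)

theorem eventually_contDiffAt_legLoc (hL : ContMDiff (ITan E) 𝓘(ℝ, ℝ) ∞ L) {q₀ : Q} {z : E × E}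
    (hz : z.1 ∈ (chartAt E q₀).target) : ∀ᶠ w in 𝓝 z, ContDiffAt ℝ ∞ (legLoc L q₀) w := by
  filter_upwards [continuous_fst.continuousAt.eventually ((chartAt E q₀).open_target.mem_nhds hz)]
    with w hw using contDiffAt_legLoc hL hw

theorem fderiv_legLoc (hL : ContMDiff (ITan E) 𝓘(ℝ, ℝ) ∞ L) {q₀ : Q} {z : E × E}
    (hz : z.1 ∈ (chartAt E q₀).target) (ζ : E × E) :
    fderiv ℝ (legLoc L q₀) z ζ = (ζ.1,
      (fderiv ℝ (fderiv ℝ (lagrLoc L q₀)) z ζ).comp (ContinuousLinearMap.inr ℝ E E)) := by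
  have h := ((contDiffAt_lagrLoc hL hz).fderiv_right (m := ∞) (by simp)).differentiableAt (by simp)
  have h2 := (h.hasFDerivAt.clm_comp (hasFDerivAt_const (ContinuousLinearMap.inr ℝ E E) z))
  have h3 := (hasFDerivAt_fst (𝕜 := ℝ) (p := z)).prodMk h2
  have h4 : fderiv ℝ (legLoc L q₀) z = _ := h3.fderiv
  rw [h4]
  simp

theorem lagrLoc_tanChart {q₀ : Q} {v : TQ E Q} (hv : v.proj ∈ (chartAt E q₀).source) :
    lagrLoc L q₀ (tanChart q₀ v) = L v :=
  congrArg L ((tanChart q₀).left_inv (by rw [tanChart_source]; exact hv))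

/-- The coordinate map is linear on each tangent space, so the chain rule turns the intrinsic fibre
derivative into the partial derivative `∂L/∂v`. -/
theorem cotChart_FL (hL : ContMDiff (ITan E) 𝓘(ℝ, ℝ) ∞ L) {q₀ : Q} {v : TQ E Q}
    (hv : v.proj ∈ (chartAt E q₀).source) :
    cotChart q₀ (FL L v) = legLoc L q₀ (tanChart q₀ v) := by
  have hz := (chartAt E q₀).map_source hv
  obtain ⟨q, v⟩ := v
  have hv : q ∈ (chartAt E q₀).source := hv
  rw [cotChart_apply, legLoc, tanChart_apply hv]
  refine Prod.ext rfl ?_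
  have key : ∀ (l : E →L[ℝ] E) (f : E → ℝ) (w : E),
      DifferentiableAt ℝ (lagrLoc L q₀) (chartAt E q₀ q, l w) →
      (∀ w, lagrLoc L q₀ (chartAt E q₀ q, l w) = f w) →
      fderiv ℝ f w = (fderiv ℝ (lagrLoc L q₀) (chartAt E q₀ q, l w)).comp
        ((ContinuousLinearMap.inr ℝ E E).comp l) := by
    intro l f w hd hf
    have h1 : HasFDerivAt (fun w : E => ((chartAt E q₀ q : E), l w))
        ((ContinuousLinearMap.inr ℝ E E).comp l) w :=
      (hasFDerivAt_const _ _).prodMk l.hasFDerivAt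
    rw [← (funext hf : (fun w => lagrLoc L q₀ (chartAt E q₀ q, l w)) = f)]
    exact (hd.hasFDerivAt.comp w h1).fderiv
  have h1 := key (vecCoord q₀ q) (fun w => L ⟨q, w⟩) v
    ((contDiffAt_lagrLoc hL hz).differentiableAt (by simp)) (fun w => by
      have := lagrLoc_tanChart (L := L) (q₀ := q₀) (v := ⟨q, w⟩) hv
      rwa [tanChart_apply hv] at this)
  ext u
  refine (congrArg (fun l : E →L[ℝ] ℝ => l (vecOfCoord q₀ q u)) h1).trans ?_
  exact congrArg (fun w : E => fderiv ℝ (lagrLoc L q₀) (chartAt E q₀ q, vecCoord q₀ q v) (0, w))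
    (vecCoord_vecOfCoord hv u)

theorem FL_eq (hL : ContMDiff (ITan E) 𝓘(ℝ, ℝ) ∞ L) {q₀ : Q} {v : TQ E Q}
    (hv : v.proj ∈ (chartAt E q₀).source) :
    FL L v = (cotChart q₀).symm (legLoc L q₀ (tanChart q₀ v)) := by
  rw [← cotChart_FL hL hv]
  exact ((cotChart q₀).left_inv (by rw [cotChart_source]; exact hv)).symm

theorem proj_tanChart_symm {q₀ : Q} {z : E × E} (hz : z.1 ∈ (chartAt E q₀).target) :
    ((tanChart q₀).symm z : TQ E Q).proj ∈ (chartAt E q₀).source := by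
  rw [tanChart_symm_apply hz]
  exact (chartAt E q₀).map_target hz

theorem cotChart_FL_tanChart_symm (hL : ContMDiff (ITan E) 𝓘(ℝ, ℝ) ∞ L) {q₀ : Q} {z : E × E}
    (hz : z.1 ∈ (chartAt E q₀).target) :
    cotChart q₀ (FL L ((tanChart q₀).symm z)) = legLoc L q₀ z := by
  rw [cotChart_FL hL (proj_tanChart_symm hz), (tanChart q₀).right_inv (mem_target_iff_tan.2 hz)]

theorem FL_tanChart_symm (hL : ContMDiff (ITan E) 𝓘(ℝ, ℝ) ∞ L) {q₀ : Q} {z : E × E}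
    (hz : z.1 ∈ (chartAt E q₀).target) :
    FL L ((tanChart q₀).symm z) = (cotChart q₀).symm (legLoc L q₀ z) := by
  rw [FL_eq hL (proj_tanChart_symm hz), (tanChart q₀).right_inv (mem_target_iff_tan.2 hz)]

theorem contMDiff_FL (hL : ContMDiff (ITan E) 𝓘(ℝ, ℝ) ∞ L) :
    ContMDiff (ITan E) (ICot E) ∞ (FL L) := by
  intro v
  have hz : (tanChart v.proj v).1 ∈ (chartAt E v.proj).target :=
    mem_target_iff_tan.1 (mem_extChartAt_target (I := ITan E) v)
  have h1 : ContMDiffAt (ITan E) 𝓘(ℝ, E × E) ∞ (tanChart v.proj) v :=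
    contMDiffAt_extChartAt (I := ITan E) (x := v)
  have h2 : ContMDiffAt 𝓘(ℝ, E × E) 𝓘(ℝ, E × (E →L[ℝ] ℝ)) ∞ (legLoc L v.proj) (tanChart v.proj v) :=
    (contDiffAt_legLoc hL hz).contMDiffAt
  have h3 : ContMDiffAt 𝓘(ℝ, E × (E →L[ℝ] ℝ)) (ICot E) ∞
      ((cotChart v.proj).symm : _ → TstarQ E Q) (legLoc L v.proj (tanChart v.proj v)) :=
    (contMDiffOn_extChartAt_symm (FL L v)).contMDiffAt
      ((isOpen_extChartAt_target _).mem_nhds (mem_target_iff_cot.2 hz))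
  refine (h3.comp v (h2.comp v h1)).congr_of_eventuallyEq ?_
  filter_upwards [extChartAt_source_mem_nhds (I := ITan E) v] with w hw
  refine FL_eq hL ?_
  rwa [extChartAt_tan, tanChart_source] at hw

theorem mfderiv_FL (hL : ContMDiff (ITan E) 𝓘(ℝ, ℝ) ∞ L) (v : TQ E Q)
    (U : TangentSpace (ITan E) v) :
    mfderiv (ITan E) (ICot E) (FL L) v U =
      fderiv ℝ (legLoc L v.proj) (tanChart v.proj v) (U : E × E) := by
  have hz : (tanChart v.proj v).1 ∈ (chartAt E v.proj).target :=
    mem_target_iff_tan.1 (mem_extChartAt_target (I := ITan E) v)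
  have h : HasMFDerivAt (ITan E) (ICot E) (FL L) v
      (fderiv ℝ (legLoc L v.proj) (tanChart v.proj v)) := by
    refine hasMFDerivAt_of_coordinates ((contMDiff_FL hL).continuous.continuousAt) ?_
    refine (((contDiffAt_legLoc hL hz).differentiableAt
      (by simp)).hasFDerivAt).congr_of_eventuallyEq ?_
    filter_upwards [extChartAt_target_mem_nhds (I := ITan E) v] with z hz'
    exact cotChart_FL_tanChart_symm hL (mem_target_iff_tan.1 hz')
  rw [h.mfderiv]
  rfl

theorem energy_eq (hL : ContMDiff (ITan E) 𝓘(ℝ, ℝ) ∞ L) {q₀ : Q} {v : TQ E Q}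
    (hv : v.proj ∈ (chartAt E q₀).source) :
    energy L v = (legLoc L q₀ (tanChart q₀ v)).2 (tanChart q₀ v).2 -
      lagrLoc L q₀ (tanChart q₀ v) := by
  rw [energy, lagrLoc_tanChart hv, ← cotChart_FL hL hv, tanChart_apply hv]
  exact congrArg (· - L v) (cotChart_pairing (α := FL L v) hv v.2).symm

theorem tanChart_pr₁ {q₀ : Q} {x : Whitney E Q} (hx : x.proj ∈ (chartAt E q₀).source) :
    tanChart q₀ (pr₁ x) = ((whChart q₀ x).1, (whChart q₀ x).2.1) := by
  rw [tanChart_apply (v := pr₁ x) hx, whChart_apply hx]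
  rfl

theorem cotChart_pr₂ {q₀ : Q} {x : Whitney E Q} (hx : x.proj ∈ (chartAt E q₀).source) :
    cotChart q₀ (pr₂ x) = ((whChart q₀ x).1, (whChart q₀ x).2.2) := by
  rw [cotChart_apply, whChart_apply hx]
  rfl

theorem D_eq {q₀ : Q} {x : Whitney E Q} (hx : x.proj ∈ (chartAt E q₀).source) :
    D L x = (whChart q₀ x).2.2 (whChart q₀ x).2.1 -
      lagrLoc L q₀ ((whChart q₀ x).1, (whChart q₀ x).2.1) := by
  rw [← tanChart_pr₁ hx, lagrLoc_tanChart (v := pr₁ x) hx, D]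
  congr 1
  have h1 := cotChart_pairing (α := pr₂ x) hx x.2.1
  rw [cotChart_pr₂ hx] at h1
  rw [← show vecCoord q₀ x.proj x.2.1 = (whChart q₀ x).2.1 by rw [whChart_apply hx]]
  exact h1.symm

/-- The derivative of the energy in coordinates. -/
theorem hasFDerivAt_energyLoc (hL : ContMDiff (ITan E) 𝓘(ℝ, ℝ) ∞ L) {q₀ : Q} {z : E × E}
    (hz : z.1 ∈ (chartAt E q₀).target) :
    ∃ l : E × E →L[ℝ] ℝ, HasFDerivAt (fun z => (legLoc L q₀ z).2 z.2 - lagrLoc L q₀ z) l z ∧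
      ∀ ζ, l ζ = (fderiv ℝ (legLoc L q₀) z ζ).2 z.2 - fderiv ℝ (lagrLoc L q₀) z (ζ.1, 0) := by
  have h1 := ((contDiffAt_legLoc hL hz).differentiableAt (by simp)).hasFDerivAt
  have h2 := ((contDiffAt_lagrLoc hL hz).differentiableAt (by simp)).hasFDerivAt
  have h3 := (hasFDerivAt_snd.comp z h1).clm_apply (hasFDerivAt_snd (𝕜 := ℝ) (p := z))
  refine ⟨_, h3.sub h2, fun ζ => ?_⟩
  -- The fibre part of `dL` cancels `p ζ.2`, because `p = ∂L/∂v`.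
  have h4 : fderiv ℝ (lagrLoc L q₀) z ζ = fderiv ℝ (lagrLoc L q₀) z (ζ.1, 0) +
      fderiv ℝ (lagrLoc L q₀) z (0, ζ.2) := by
    rw [← map_add]; simp
  simp [h4, legLoc]
  ring

end Lagrangian

/-! ### Coordinates on `M₁` adapted to `FL`. -/

section AlmostRegularSection
variable {E : Type*} [NormedAddCommGroup E] [NormedSpace ℝ E] [FiniteDimensional ℝ E]
    {Q : Type*} [TopologicalSpace Q] [ChartedSpace E Q] [IsManifold 𝓘(ℝ, E) ∞ Q]
    {L : TQ E Q → ℝ}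

omit [FiniteDimensional ℝ E] in
theorem tanChart_fst_mem (v : TQ E Q) : (tanChart v.proj v).1 ∈ (chartAt E v.proj).target :=
  mem_target_iff_tan.1 (mem_extChartAt_target (I := ITan E) v)

theorem fderiv_comp_apply_eq {A B C : Type*} [NormedAddCommGroup A] [NormedSpace ℝ A]
    [NormedAddCommGroup B] [NormedSpace ℝ B] [NormedAddCommGroup C] [NormedSpace ℝ C]
    {g : B → C} {f : A → B} {a u : A} {w : B} {ζ : C} (hg : DifferentiableAt ℝ g (f a))
    (hf : DifferentiableAt ℝ f a) (hu : fderiv ℝ f a u = w) (hw : fderiv ℝ g (f a) w = ζ) :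
    fderiv ℝ (g ∘ f) a u = ζ := by
  rw [fderiv_comp a hg hf, ContinuousLinearMap.comp_apply, hu, hw]

/-- Local coordinates `R` on the image of the Legendre transformation of an almost regular
Lagrangian, in which the Legendre transformation becomes a submersion of vector spaces; `T` is the
corresponding parametrization of the image. -/
theorem AlmostRegular.exists_image_coordinates (hL : ContMDiff (ITan E) 𝓘(ℝ, ℝ) ∞ L)
    (hreg : AlmostRegular L) (v : TQ E Q) :
    ∃ (V : Submodule ℝ (E × (E →L[ℝ] ℝ))) (T : V → E × (E →L[ℝ] ℝ)) (R : E × (E →L[ℝ] ℝ) → V),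
      (∀ᶠ z in 𝓝 (legLoc L v.proj (tanChart v.proj v)), ContDiffAt ℝ ∞ R z) ∧
      (∀ᶠ y in 𝓝 (R (legLoc L v.proj (tanChart v.proj v))), ContDiffAt ℝ ∞ T y) ∧
      (∀ᶠ z in 𝓝 (legLoc L v.proj (tanChart v.proj v)),
        ((cotChart v.proj).symm z : TstarQ E Q) ∈ range (FL L) → T (R z) = z) ∧
      Function.Surjective (fderiv ℝ (R ∘ legLoc L v.proj) (tanChart v.proj v)) := by
  set x : TstarQ E Q := FL L v with hx
  have hfa : legLoc L v.proj (tanChart v.proj v) = cotChart v.proj x :=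
    (cotChart_FL hL (mem_chart_source E v.proj)).symm
  have hcx : (cotChart v.proj).symm (cotChart v.proj x) = x := extChartAt_to_inv (I := ICot E) x
  obtain ⟨e, he, hxe, V, hV⟩ := hreg.submanifold x ⟨v, rfl⟩
  obtain ⟨P, hP⟩ := Submodule.ClosedComplemented.of_finiteDimensional V
  set φ := e.extend (ICot E) with hφ
  have hφs : φ.source = e.source := e.extend_source
  have hφx : φ.symm (φ x) = x := φ.left_inv (by rwa [hφs])
  have hcont : ContinuousAt (cotChart v.proj).symm (cotChart v.proj x) :=
    continuousAt_extChartAt_symm (I := ICot E) x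
  have hsrc : ∀ᶠ z in 𝓝 (cotChart v.proj x),
      ((cotChart v.proj).symm z : TstarQ E Q) ∈ e.source :=
    hcont.eventually (by rw [hcx]; exact e.open_source.mem_nhds hxe)
  have htgt : ∀ᶠ z in 𝓝 (cotChart v.proj x),
      z ∈ (cotChart v.proj : PartialEquiv (TstarQ E Q) _).target :=
    extChartAt_target_mem_nhds (I := ICot E) x
  -- In the chart `e` the set `M₁` is the flat piece `φ x + V`; `R` reads off and projects the
  -- `V`-coordinate, and `T` goes back.
  let R : E × (E →L[ℝ] ℝ) → V := fun z => P (φ ((cotChart v.proj).symm z) - φ x)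
  let T : V → E × (E →L[ℝ] ℝ) := fun y => cotChart v.proj (φ.symm (φ x + y))
  have hR0 : R (cotChart v.proj x) = 0 := by simp [R, hcx]
  have hRs : ∀ᶠ z in 𝓝 (cotChart v.proj x), ContDiffAt ℝ ∞ R z := by
    filter_upwards [hsrc, htgt] with z hz1 hz2
    have h1 : ContMDiffAt (ICot E) 𝓘(ℝ, E × (E →L[ℝ] ℝ)) ∞ φ ((cotChart v.proj).symm z) :=
      (OpenPartialHomeomorph.contMDiffOn_extend he).contMDiffAt (e.open_source.mem_nhds hz1)
    have h2 : ContMDiffAt 𝓘(ℝ, E × (E →L[ℝ] ℝ)) (ICot E) ∞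
        ((cotChart v.proj).symm : _ → TstarQ E Q) z :=
      (contMDiffOn_extChartAt_symm x).contMDiffAt ((isOpen_extChartAt_target x).mem_nhds hz2)
    have h3 : ContDiffAt ℝ ∞ (φ ∘ (cotChart v.proj).symm) z :=
      contMDiffAt_iff_contDiffAt.1 (h1.comp z h2)
    exact P.contDiff.contDiffAt.comp z (h3.sub contDiffAt_const)
  have hadd : Filter.Tendsto (fun y : V => φ x + (y : E × (E →L[ℝ] ℝ))) (𝓝 0) (𝓝 (φ x)) := by
    have : Continuous (fun y : V => φ x + (y : E × (E →L[ℝ] ℝ))) := by fun_prop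
    simpa using this.tendsto 0
  have htφ : ∀ᶠ y : V in 𝓝 0, φ x + (y : E × (E →L[ℝ] ℝ)) ∈ φ.target :=
    hadd.eventually (e.isOpen_extend_target.mem_nhds (φ.map_source (by rwa [hφs])))
  have hsymm : ContinuousAt φ.symm (φ x) := e.continuousAt_extend_symm hxe
  have hsrcx : ∀ᶠ y : V in 𝓝 0, φ.symm (φ x + (y : E × (E →L[ℝ] ℝ))) ∈
      (extChartAt (ICot E) x).source := by
    refine (Filter.Tendsto.comp hsymm hadd).eventually ?_
    rw [hφx]
    exact extChartAt_source_mem_nhds x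
  have hsymms : ∀ᶠ y : V in 𝓝 0, ContMDiffAt 𝓘(ℝ, V) (ICot E) ∞
      (fun y : V => φ.symm (φ x + (y : E × (E →L[ℝ] ℝ)))) y := by
    filter_upwards [htφ] with y hy1
    have h1 : ContMDiffAt 𝓘(ℝ, E × (E →L[ℝ] ℝ)) (ICot E) ∞ φ.symm
        (φ x + (y : E × (E →L[ℝ] ℝ))) := by
      refine (contMDiffOn_extend_symm he).contMDiffAt ?_
      have : φ.target ∈ 𝓝 (φ x + (y : E × (E →L[ℝ] ℝ))) :=
        e.isOpen_extend_target.mem_nhds hy1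
      refine Filter.mem_of_superset this ?_
      rw [hφ, e.extend_target']
    have h2 : ContDiff ℝ ∞ (fun y : V => φ x + (y : E × (E →L[ℝ] ℝ))) :=
      contDiff_const.add V.subtypeL.contDiff
    exact h1.comp y h2.contMDiff.contMDiffAt
  have hTs : ∀ᶠ y in 𝓝 (0 : V), ContDiffAt ℝ ∞ T y := by
    filter_upwards [hsymms, hsrcx] with y hy1 hy2
    have h3 : ContMDiffAt (ICot E) 𝓘(ℝ, E × (E →L[ℝ] ℝ)) ∞ (extChartAt (ICot E) x)
        (φ.symm (φ x + (y : E × (E →L[ℝ] ℝ)))) :=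
      contMDiffAt_extChartAt' (by rwa [extChartAt_source] at hy2)
    exact contMDiffAt_iff_contDiffAt.1 (h3.comp y hy1)
  have hRT : ∀ᶠ y in 𝓝 (0 : V), R (T y) = y := by
    filter_upwards [htφ, hsrcx] with y hy1 hy2
    have h1 : (cotChart v.proj).symm (T y) = φ.symm (φ x + (y : E × (E →L[ℝ] ℝ))) :=
      (extChartAt (ICot E) x).left_inv hy2
    simp only [R, h1, φ.right_inv hy1, add_sub_cancel_left, hP]
  have hT0 : T 0 = cotChart v.proj x := by simp [T, hφx]
  refine ⟨V, T, R, by rwa [hfa], by rwa [hfa, hR0], ?_, ?_⟩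
  · rw [hfa]
    filter_upwards [hsrc, htgt] with z hz1 hz2 hz3
    have h1 : φ ((cotChart v.proj).symm z) - φ x ∈ V := (hV _ hz1).1 hz3
    have h2 : ((R z : V) : E × (E →L[ℝ] ℝ)) = φ ((cotChart v.proj).symm z) - φ x :=
      congrArg Subtype.val (hP ⟨_, h1⟩)
    simp only [T, h2, add_sub_cancel]
    rw [φ.left_inv (by rwa [hφs])]
    exact (cotChart v.proj).right_inv hz2
  -- The curve `t ↦ T (t ζ)` lies in `M₁`, so its velocity is `TFL(U)` for some `U` by the
  -- submersion hypothesis; `R ∘ T = id` then sends it to `ζ`.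
  · intro ζ
    have dT : HasFDerivAt T (fderiv ℝ T 0) 0 :=
      (hTs.self_of_nhds.differentiableAt (by simp)).hasFDerivAt
    have dR : HasFDerivAt R (fderiv ℝ R (T 0)) (T 0) := by
      rw [hT0]
      exact (hRs.self_of_nhds.differentiableAt (by simp)).hasFDerivAt
    have hRTd : fderiv ℝ R (T 0) (fderiv ℝ T 0 ζ) = ζ := by
      have h1 := (dR.comp (0 : V) dT).unique
        ((hasFDerivAt_id (𝕜 := ℝ) (0 : V)).congr_of_eventuallyEq hRT)
      exact congrArg (fun l => l ζ) h1
    have hl : HasDerivAt (fun t : ℝ => t • ζ) ζ 0 := by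
      simpa using (hasDerivAt_id (0 : ℝ)).smul_const ζ
    have hl0 : Filter.Tendsto (fun t : ℝ => t • ζ) (𝓝 0) (𝓝 0) := by
      simpa using hl.continuousAt.tendsto
    have hcurve : IsCurveIn (ICot E) (range (FL L)) x (fderiv ℝ T 0 ζ : E × (E →L[ℝ] ℝ))
        (fun t : ℝ => φ.symm (φ x + ((t • ζ : V) : E × (E →L[ℝ] ℝ)))) := by
      refine isCurveIn_of_hasDerivAt (by simp [hφx]) ?_ ?_ ?_
      · filter_upwards [hl0.eventually htφ] with t ht
        refine (hV _ ?_).2 ?_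
        · rw [← hφs]; exact φ.map_target ht
        · change φ (φ.symm _) - φ x ∈ V
          rw [φ.right_inv ht, add_sub_cancel_left]
          exact (t • ζ).2
      · filter_upwards [hl0.eventually hsymms] with t ht
        have : ContDiff ℝ ∞ (fun t : ℝ => t • ζ) := contDiff_id.smul contDiff_const
        exact ContMDiffAt.comp (I' := 𝓘(ℝ, V))
          (g := fun y : V => φ.symm (φ x + (y : E × (E →L[ℝ] ℝ))))
          (f := fun t : ℝ => t • ζ) t ht this.contMDiff.contMDiffAt
      · have := HasFDerivAt.comp_hasDerivAt (x := (0 : ℝ)) (l := T) (f := fun t : ℝ => t • ζ)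
          (by rw [zero_smul]; exact dT) hl
        exact this
    obtain ⟨U, hU⟩ := hreg.submersion v _ ⟨_, hcurve⟩
    have hU' : fderiv ℝ (legLoc L v.proj) (tanChart v.proj v) (U : E × E) = fderiv ℝ T 0 ζ :=
by
      have h9 := mfderiv_FL hL v U
      rw [hU] at h9
      exact h9.symm
    have df : DifferentiableAt ℝ (legLoc L v.proj) (tanChart v.proj v) :=
      (contDiffAt_legLoc hL (tanChart_fst_mem v)).differentiableAt (by simp)
    rw [hT0, ← hfa] at hRTd
    rw [← hfa] at hRs
    have dR2 : DifferentiableAt ℝ R (legLoc L v.proj (tanChart v.proj v)) :=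
      hRs.self_of_nhds.differentiableAt (by simp)
    exact ⟨(U : E × E), fderiv_comp_apply_eq (A := E × E) (B := E × (E →L[ℝ] ℝ)) (C := V) (g := R)
      (f := legLoc L v.proj) (hRs.self_of_nhds.differentiableAt (by simp)) df hU' hRTd⟩

end AlmostRegularSection

/-! ### Maps that are submersions onto a parametrized subset. -/

section ImageCoordinates
variable {A : Type*} [NormedAddCommGroup A] [NormedSpace ℝ A] [FiniteDimensional ℝ A]
  {B : Type*} [NormedAddCommGroup B] [NormedSpace ℝ B]
  {V : Type*} [NormedAddCommGroup V] [NormedSpace ℝ V]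

/-- `R` and `T` are inverse coordinates and parametrization of a set `S` near `f a`, in which the
map `f` into `S` is a submersion at `a`. -/
structure IsSubmersionOnto (f : A → B) (a : A) (S : Set B) (T : V → B) (R : B → V) : Prop where
  map_smooth : ∀ᶠ b in 𝓝 a, ContDiffAt ℝ ∞ f b
  map_mem : ∀ᶠ b in 𝓝 a, f b ∈ S
  coord_smooth : ∀ᶠ z in 𝓝 (f a), ContDiffAt ℝ ∞ R z
  param_smooth : ∀ᶠ y in 𝓝 (R (f a)), ContDiffAt ℝ ∞ T y
  param_coord : ∀ᶠ z in 𝓝 (f a), z ∈ S → T (R z) = z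
  surjective : Function.Surjective (fderiv ℝ (R ∘ f) a)

variable {f : A → B} {a : A} {S : Set B} {T : V → B} {R : B → V}

omit [FiniteDimensional ℝ A] in
theorem IsSubmersionOnto.smooth_comp (h : IsSubmersionOnto f a S T R) :
    ∀ᶠ b in 𝓝 a, ContDiffAt ℝ ∞ (R ∘ f) b := by
  filter_upwards [h.map_smooth, h.map_smooth.self_of_nhds.continuousAt.eventually h.coord_smooth]
    with b h1 h2 using h2.comp b h1

omit [FiniteDimensional ℝ A] in
theorem IsSubmersionOnto.factor (h : IsSubmersionOnto f a S T R) :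
    ∀ᶠ b in 𝓝 a, T ((R ∘ f) b) = f b := by
  filter_upwards [h.map_mem, h.map_smooth.self_of_nhds.continuousAt.eventually h.param_coord]
    with b h1 h2 using h2 h1

/-- Smooth curves in the image lift. -/
theorem IsSubmersionOnto.exists_lift (h : IsSubmersionOnto f a S T R) {γ : ℝ → B} (h0 : γ 0 = f a)
    (hs : ∀ᶠ t in 𝓝 (0 : ℝ), ContDiffAt ℝ ∞ γ t) (hS : ∀ᶠ t in 𝓝 (0 : ℝ), γ t ∈ S) :
    ∃ c : ℝ → A, c 0 = a ∧ (∀ᶠ t in 𝓝 (0 : ℝ), ContDiffAt ℝ ∞ c t) ∧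
      ∀ᶠ t in 𝓝 (0 : ℝ), f (c t) = γ t := by
  obtain ⟨s, hs0, hs1, hs2⟩ := exists_local_section h.smooth_comp h.surjective
  have hγ : Filter.Tendsto γ (𝓝 0) (𝓝 (f a)) := by
    have := hs.self_of_nhds.continuousAt.tendsto
    rwa [h0] at this
  have hRγ : Filter.Tendsto (fun t => R (γ t)) (𝓝 0) (𝓝 ((R ∘ f) a)) :=
    h.coord_smooth.self_of_nhds.continuousAt.tendsto.comp hγ
  have hsγ : Filter.Tendsto (fun t => s (R (γ t))) (𝓝 0) (𝓝 a) := by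
    have := hs1.self_of_nhds.continuousAt.tendsto
    rw [hs0] at this
    exact this.comp hRγ
  -- With `s` a local section of `R ∘ f`, the factorization `f = T ∘ R ∘ f` gives `f (s (R γ)) = T
  -- (R γ) = γ`.
  refine ⟨fun t => s (R (γ t)), (congrArg (fun y => s (R y)) h0).trans hs0, ?_, ?_⟩
  · filter_upwards [hs, hγ.eventually h.coord_smooth, hRγ.eventually hs1] with t h1 h2 h3
    exact h3.comp t (h2.comp t h1)
  · filter_upwards [hS, hγ.eventually h.param_coord, hRγ.eventually hs2, hsγ.eventually h.factor]
      with t h1 h2 h3 h4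
    rw [← h4, h3, h2 h1]

/-- The kernel of `Df` lies in that of `D(R ∘ f)`, and near `a` the fibres of `R ∘ f` are fibres of
`f`, because `f = T ∘ R ∘ f`. -/
theorem IsSubmersionOnto.exists_curve_in_fibre (h : IsSubmersionOnto f a S T R) {w : A}
    (hw : fderiv ℝ f a w = 0) :
    ∃ c : ℝ → A, c 0 = a ∧ HasDerivAt c w 0 ∧ ∀ᶠ t in 𝓝 (0 : ℝ), f (c t) = f a := by
  have h1 : fderiv ℝ (R ∘ f) a w = 0 :=
    fderiv_comp_apply_eq (h.coord_smooth.self_of_nhds.differentiableAt (by simp))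
      (h.map_smooth.self_of_nhds.differentiableAt (by simp)) hw (map_zero _)
  obtain ⟨c, hc0, hcd, hc⟩ := SkinnerRusk.exists_curve_in_fibre h.smooth_comp h.surjective h1
  have hca : Filter.Tendsto c (𝓝 0) (𝓝 a) := by
    have := hcd.continuousAt.tendsto
    rwa [hc0] at this
  refine ⟨c, hc0, hcd, ?_⟩
  filter_upwards [hc, hca.eventually h.factor] with t h1 h2
  rw [← h2, h1, h.factor.self_of_nhds]

/-- Differentiating `f = T ∘ (R ∘ f)` shows that the kernel of `D(R ∘ f)` lies in that of `Df`,
which reduces the claim to the submersion `R ∘ f`. -/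
theorem IsSubmersionOnto.eventually_eq_on_fibre (h : IsSubmersionOnto f a S T R) {k : A → ℝ}
    (hk : ∀ᶠ b in 𝓝 a, DifferentiableAt ℝ k b ∧
      ∀ w, fderiv ℝ f b w = 0 → fderiv ℝ k b w = 0) :
    ∀ᶠ b in 𝓝 a, f b = f a → k b = k a := by
  have hRf : Filter.Tendsto (R ∘ f) (𝓝 a) (𝓝 (R (f a))) :=
    h.smooth_comp.self_of_nhds.continuousAt.tendsto
  have := SkinnerRusk.eventually_eq_on_fibre (h := k) h.smooth_comp h.surjective (by
    filter_upwards [hk, h.factor.eventually_nhds, h.smooth_comp, hRf.eventually h.param_smooth]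
      with b h1 h2 h3 h4
    refine ⟨h1.1, fun w hw => h1.2 w ?_⟩
    have h5 : (T ∘ (R ∘ f)) =ᶠ[𝓝 b] f := h2
    rw [← h5.fderiv_eq]
    exact fderiv_comp_apply_eq (h4.differentiableAt (by simp)) (h3.differentiableAt (by simp)) hw
      (map_zero _))
  exact this.mono fun b hb hfb => hb (congrArg R hfb)

end ImageCoordinates

/-! ### Lifting curves through `FL`, and constancy of the energy on its fibres. -/

section AlmostRegularII
variable {E : Type*} [NormedAddCommGroup E] [NormedSpace ℝ E] [FiniteDimensional ℝ E]
    {Q : Type*} [TopologicalSpace Q] [ChartedSpace E Q] [IsManifold 𝓘(ℝ, E) ∞ Q]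
    {L : TQ E Q → ℝ}

theorem AlmostRegular.isSubmersionOnto (hL : ContMDiff (ITan E) 𝓘(ℝ, ℝ) ∞ L)
    (hreg : AlmostRegular L) (v : TQ E Q) :
    ∃ (V : Submodule ℝ (E × (E →L[ℝ] ℝ))) (T : V → E × (E →L[ℝ] ℝ)) (R : E × (E →L[ℝ] ℝ) → V),
      IsSubmersionOnto (legLoc L v.proj) (tanChart v.proj v)
        {z | ((cotChart v.proj).symm z : TstarQ E Q) ∈ range (FL L)} T R := by
  obtain ⟨V, T, R, h1, h2, h3, h4⟩ := hreg.exists_image_coordinates hL v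
  refine ⟨V, T, R, eventually_contDiffAt_legLoc hL (tanChart_fst_mem v), ?_, h1, h2, h3, h4⟩
  filter_upwards [extChartAt_target_mem_nhds (I := ITan E) v] with z hz
  exact ⟨_, FL_tanChart_symm hL (mem_target_iff_tan.1 hz)⟩

/-- A curve in the image of the Legendre transformation lifts, in coordinates, to a smooth curve of
velocities. -/
theorem AlmostRegular.exists_lift (hL : ContMDiff (ITan E) 𝓘(ℝ, ℝ) ∞ L)
    (hreg : AlmostRegular L) (v : TQ E Q) {Z : TangentSpace (ICot E) (FL L v)}
    {γ : ℝ → TstarQ E Q} (hγ : IsCurveIn (ICot E) (range (FL L)) (FL L v) Z γ) :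
    ∃ c : ℝ → E × E, c 0 = tanChart v.proj v ∧ (∀ᶠ t in 𝓝 (0 : ℝ), ContDiffAt ℝ ∞ c t) ∧
      ∀ᶠ t in 𝓝 (0 : ℝ), FL L ((tanChart v.proj).symm (c t)) = γ t := by
  obtain ⟨V, T, R, h⟩ := hreg.isSubmersionOnto hL v
  have hc := hγ.eventually_contMDiffAt.self_of_nhds.continuousAt
  have hsrc : ∀ᶠ t in 𝓝 (0 : ℝ), γ t ∈ (extChartAt (ICot E) (FL L v)).source := by
    refine hc.eventually ?_
    rw [hγ.apply_zero]
    exact extChartAt_source_mem_nhds _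
  have hleft : ∀ᶠ t in 𝓝 (0 : ℝ), (cotChart v.proj).symm (cotChart v.proj (γ t)) = γ t :=
    hsrc.mono fun t ht => (extChartAt (ICot E) (FL L v)).left_inv ht
  obtain ⟨c, hc0, hc1, hc2⟩ := h.exists_lift (γ := fun t => cotChart v.proj (γ t))
    (by rw [hγ.apply_zero]; exact cotChart_FL hL (mem_chart_source E v.proj))
    (by
      filter_upwards [hγ.eventually_contMDiffAt, hsrc] with t h1 h2
      have h3 : ContMDiffAt (ICot E) 𝓘(ℝ, E × (E →L[ℝ] ℝ)) ∞ (extChartAt (ICot E) (FL L v)) (γ t) :=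
        contMDiffAt_extChartAt' (by rwa [extChartAt_source] at h2)
      exact contMDiffAt_iff_contDiffAt.1 (h3.comp t h1))
    (by
      filter_upwards [hleft, hγ.eventually_mem] with t h1 h2
      exact h1.symm ▸ h2)
  refine ⟨c, hc0, hc1, ?_⟩
  have hct : ∀ᶠ t in 𝓝 (0 : ℝ), c t ∈ (extChartAt (ITan E) v).target := by
    refine hc1.self_of_nhds.continuousAt.eventually ?_
    rw [hc0]
    exact extChartAt_target_mem_nhds v
  filter_upwards [hc2, hct, hleft] with t h1 h2 h3
  rw [FL_tanChart_symm hL (mem_target_iff_tan.1 h2), h1, h3]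

theorem AlmostRegular.exists_curve_in_fibre (hL : ContMDiff (ITan E) 𝓘(ℝ, ℝ) ∞ L)
    (hreg : AlmostRegular L) (v : TQ E Q) {w : E × E}
    (hw : fderiv ℝ (legLoc L v.proj) (tanChart v.proj v) w = 0) :
    ∃ c : ℝ → E × E, c 0 = tanChart v.proj v ∧ HasDerivAt c w 0 ∧
      ∀ᶠ t in 𝓝 (0 : ℝ), legLoc L v.proj (c t) = legLoc L v.proj (tanChart v.proj v) := by
  obtain ⟨V, T, R, h⟩ := hreg.isSubmersionOnto hL v
  exact h.exists_curve_in_fibre hw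

/-- A vector killed by `TFL` has no `q`-component, and `dE_L` of such a vector is a pairing with its
image under `TFL`, hence zero. -/
theorem AlmostRegular.energy_eventually_eq (hL : ContMDiff (ITan E) 𝓘(ℝ, ℝ) ∞ L)
    (hreg : AlmostRegular L) (v : TQ E Q) :
    ∀ᶠ w in 𝓝 v, FL L w = FL L v → energy L w = energy L v := by
  obtain ⟨V, T, R, h⟩ := hreg.isSubmersionOnto hL v
  have h1 := h.eventually_eq_on_fibre
    (k := fun z => (legLoc L v.proj z).2 z.2 - lagrLoc L v.proj z) (by
      filter_upwards [extChartAt_target_mem_nhds (I := ITan E) v] with z hz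
      obtain ⟨l, hl1, hl2⟩ := hasFDerivAt_energyLoc hL (mem_target_iff_tan.1 hz)
      refine ⟨hl1.differentiableAt, fun w hw => ?_⟩
      have hw1 : w.1 = 0 := by
        rw [fderiv_legLoc hL (mem_target_iff_tan.1 hz)] at hw
        exact congrArg Prod.fst hw
      rw [hl1.fderiv, hl2, hw, hw1]
      simp only [Prod.snd_zero, _root_.zero_apply, zero_sub, neg_eq_zero]
      exact map_zero _)
  filter_upwards [(continuousAt_extChartAt (I := ITan E) v).eventually h1,
    extChartAt_source_mem_nhds (I := ITan E) v] with w hw1 hw2 hw3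
  have hw4 : w.proj ∈ (chartAt E v.proj).source := by
    rwa [extChartAt_tan, tanChart_source] at hw2
  rw [energy_eq hL hw4, energy_eq hL (mem_chart_source E v.proj)]
  refine hw1 ?_
  rw [extChartAt_tan, ← cotChart_FL hL hw4, hw3, cotChart_FL hL (mem_chart_source E v.proj)]

/-- The energy of an almost regular Lagrangian is a function on the image of `FL`. -/
theorem AlmostRegular.h₁_FL (hL : ContMDiff (ITan E) 𝓘(ℝ, ℝ) ∞ L)
    (hreg : AlmostRegular L) (v : TQ E Q) : h₁ L (FL L v) = energy L v := by
  refine Function.FactorsThrough.extend_apply (fun u w huw => ?_) _ v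
  -- A locally constant function on a connected fibre is constant, so `Function.extend` takes a
  -- well-defined value there.
  refine (hreg.connected_fibres (FL L w) ⟨w, rfl⟩).isPreconnected.induction₂
    (fun u w => energy L u = energy L w) (fun u hu => ?_) (fun _ _ _ _ _ _ => Eq.trans)
    (fun _ _ _ _ => Eq.symm) huw rfl
  rw [eventually_nhdsWithin_iff]
  filter_upwards [hreg.energy_eventually_eq hL u] with w' h1 h2
  exact (h1 (h2.trans hu.symm)).symm

end AlmostRegularII

/-! ### The equations of motion on `TQ ⊕ T^*Q`. -/

section Equations
variable {E : Type*} [NormedAddCommGroup E] [NormedSpace ℝ E]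
    {Q : Type*} [TopologicalSpace Q] [ChartedSpace E Q] [IsManifold 𝓘(ℝ, E) ∞ Q]
    {L : TQ E Q → ℝ}

/-- Every tangent vector is the velocity of the curve that is straight in the preferred chart. -/
theorem isCurveIn_straight {F : Type*} [NormedAddCommGroup F] [NormedSpace ℝ F]
    {H : Type*} [TopologicalSpace H] {I : ModelWithCorners ℝ F H} [I.Boundaryless]
    {N : Type*} [TopologicalSpace N] [ChartedSpace H N] [IsManifold I ∞ N]
    (x : N) (Z : F) :
    IsCurveIn I univ x Z ((extChartAt I x).symm ∘ fun t : ℝ => extChartAt I x x + t • Z) := by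
  refine isCurveIn_chart (by simp) (Filter.Eventually.of_forall fun t => ?_) ?_
    (Filter.Eventually.of_forall fun t => mem_univ _)
  · exact (contDiff_const.add (contDiff_id.smul contDiff_const)).contDiffAt
  · simpa using ((hasDerivAt_id (0 : ℝ)).smul_const Z).const_add (extChartAt I x x)

theorem IsCurveIn.velocity_unique {F : Type*} [NormedAddCommGroup F] [NormedSpace ℝ F]
    {H : Type*} [TopologicalSpace H] {I : ModelWithCorners ℝ F H}
    {N : Type*} [TopologicalSpace N] [ChartedSpace H N] {S T : Set N}
    {x : N} {Z Z' : TangentSpace I x} {γ γ' : ℝ → N} (h : IsCurveIn I S x Z γ)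
    (h' : IsCurveIn I T x Z' γ') (hγ : γ =ᶠ[𝓝 0] γ') : Z = Z' := by
  have h1 := h'.hasDerivAt.congr_of_eventuallyEq
    (hγ.mono fun t ht => congrArg (extChartAt I x) ht : extChartAt I x ∘ γ =ᶠ[𝓝 0] _)
  exact h.hasDerivAt.unique h1

/-- The vector of a point of the Whitney sum, in the preferred chart at its base point. -/
def velocity (x : Whitney E Q) : E := x.2.1

/-- The covector of a point of the Whitney sum, in the preferred chart at its base point. -/
def momentum (x : Whitney E Q) : E →L[ℝ] ℝ := x.2.2

/-- The differential of the Pontryagin hamiltonian in coordinates. -/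
def dD (L : TQ E Q → ℝ) (x : Whitney E Q) (Z : E × (E × (E →L[ℝ] ℝ))) : ℝ :=
  Z.2.2 (velocity x) + momentum x Z.2.1 -
    fderiv ℝ (lagrLoc L x.proj) (tanChart x.proj (pr₁ x)) (Z.1, Z.2.1)

theorem hasDerivAt_D (hL : ContMDiff (ITan E) 𝓘(ℝ, ℝ) ∞ L) {x : Whitney E Q}
    {Z : TangentSpace (IWh E) x} {S : Set (Whitney E Q)} {γ : ℝ → Whitney E Q}
    (hγ : IsCurveIn (IWh E) S x Z γ) : HasDerivAt (D L ∘ γ) (dD L x Z) 0 := by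
  have hx := mem_chart_source E x.proj
  have hw := hγ.hasDerivAt
  have hz : (tanChart x.proj (pr₁ x)).1 ∈ (chartAt E x.proj).target :=
    tanChart_fst_mem (pr₁ x)
  have e1 : whChart x.proj x = (chartAt E x.proj x.proj, (velocity x, momentum x)) :=
    whChart_self x
  have key : ∀ (w : ℝ → E × (E × (E →L[ℝ] ℝ))) (Z : E × (E × (E →L[ℝ] ℝ))),
      w 0 = whChart x.proj x → HasDerivAt w Z 0 →
      HasDerivAt (fun t => (w t).2.2 (w t).2.1 - lagrLoc L x.proj ((w t).1, (w t).2.1))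
        (dD L x Z) 0 := by
    intro w Z h0 hw
    have hl : HasFDerivAt (lagrLoc L x.proj) (fderiv ℝ (lagrLoc L x.proj)
        (tanChart x.proj (pr₁ x))) ((w 0).1, (w 0).2.1) := by
      rw [h0, ← tanChart_pr₁ hx]
      exact ((contDiffAt_lagrLoc hL hz).differentiableAt (by simp)).hasFDerivAt
    have d1 : HasDerivAt (fun t => (w t).1) Z.1 0 := hw.fst
    have d2 : HasDerivAt (fun t => (w t).2.1) Z.2.1 0 := hw.snd.fst
    have d3 : HasDerivAt (fun t => (w t).2.2) Z.2.2 0 := hw.snd.snd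
    have d4 := (d3.clm_apply d2).sub (hl.comp_hasDerivAt (0 : ℝ) (d1.prodMk d2))
    rw [h0, e1] at d4
    exact d4
  have hs : ∀ᶠ t in 𝓝 (0 : ℝ), γ t ∈ (extChartAt (IWh E) x).source := by
    refine hγ.eventually_contMDiffAt.self_of_nhds.continuousAt.eventually ?_
    rw [hγ.apply_zero]
    exact extChartAt_source_mem_nhds x
  refine (key (extChartAt (IWh E) x ∘ γ) Z (congrArg (whChart x.proj) hγ.apply_zero)
    hw).congr_of_eventuallyEq ?_
  filter_upwards [hs] with t ht
  refine D_eq ?_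
  rwa [extChartAt_wh, whChart_source] at ht

/-- On the whole manifold each vector is the velocity of a chart-straight curve, so the condition on
curves becomes a linear identity. -/
theorem solves_whitney_iff_forall (hL : ContMDiff (ITan E) 𝓘(ℝ, ℝ) ∞ L) {x : Whitney E Q}
    {X : TangentSpace (IWh E) x} :
    Solves (IWh E) univ Omega (D L) x X ↔
      ∀ Z : TangentSpace (IWh E) x, Omega x X Z = dD L x Z := by
  refine ⟨fun h Z => ?_, fun h Z γ hγ => ?_⟩
  · have hc := isCurveIn_straight (I := IWh E) x Z
    exact (h Z _ hc).unique (hasDerivAt_D hL hc)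
  · rw [h Z]
    exact hasDerivAt_D hL hγ

theorem FL_eq_pr₂_iff (hL : ContMDiff (ITan E) 𝓘(ℝ, ℝ) ∞ L) {x : Whitney E Q} :
    FL L (pr₁ x) = pr₂ x ↔ (fderiv ℝ (lagrLoc L x.proj) (tanChart x.proj (pr₁ x))).comp
      (ContinuousLinearMap.inr ℝ E E) = momentum x := by
  have hx := mem_chart_source E x.proj
  have h1 : cotChart x.proj (FL L (pr₁ x)) = legLoc L x.proj (tanChart x.proj (pr₁ x)) :=
    cotChart_FL hL hx
  have h2 : cotChart x.proj (FL L (pr₁ x)) = _ := cotChart_self (FL L (pr₁ x))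
  have h3 : cotChart x.proj (pr₂ x) = _ := cotChart_self (pr₂ x)
  constructor
  · intro h
    rw [h, h3] at h1
    exact (congrArg Prod.snd h1).symm
  · intro h
    have : (FL L (pr₁ x)).2 = (pr₂ x).2 := by
      rw [h1] at h2
      exact (congrArg Prod.snd h2).symm.trans h
    exact congrArg (TotalSpace.mk x.proj) this

/-- The equations of motion on the Whitney sum, in coordinates `q̇ = v`, `p = ∂L/∂v`,
`ṗ = ∂L/∂q`. -/
theorem solves_whitney_iff (hL : ContMDiff (ITan E) 𝓘(ℝ, ℝ) ∞ L) {x : Whitney E Q}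
    {X : TangentSpace (IWh E) x} :
    Solves (IWh E) univ Omega (D L) x X ↔
      (X : E × (E × (E →L[ℝ] ℝ))).1 = velocity x ∧ FL L (pr₁ x) = pr₂ x ∧
      ∀ u, (X : E × (E × (E →L[ℝ] ℝ))).2.2 u =
        fderiv ℝ (lagrLoc L x.proj) (tanChart x.proj (pr₁ x)) (u, 0) := by
  rw [solves_whitney_iff_forall hL, FL_eq_pr₂_iff hL]
  have key : ∀ (X : E × (E × (E →L[ℝ] ℝ))) (u₀ : E) (p₀ : E →L[ℝ] ℝ) (l : E × E →L[ℝ] ℝ),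
      (∀ Z : E × (E × (E →L[ℝ] ℝ)),
        Z.2.2 X.1 - X.2.2 Z.1 = Z.2.2 u₀ + p₀ Z.2.1 - l (Z.1, Z.2.1)) ↔
      X.1 = u₀ ∧ l.comp (ContinuousLinearMap.inr ℝ E E) = p₀ ∧ ∀ u, X.2.2 u = l (u, 0) := by
    intro X u₀ p₀ l
    have hl0 : l ((0 : E), (0 : E)) = 0 := map_zero l
    constructor
    · intro h
      -- Testing with pure `p`-, `v`- and `q`-directions gives the three equations.
      refine ⟨?_, ?_, fun u => ?_⟩
      · refine (SeparatingDual.eq_iff_forall_dual_eq (R := ℝ)).2 fun p => ?_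
        simpa [hl0] using h (0, 0, p)
      · ext u
        have := h (0, u, 0)
        simp at this
        simp
        linarith
      · have := h (u, 0, 0)
        simp at this
        linarith
    · rintro ⟨h1, h2, h3⟩ Z
      have : l (Z.1, Z.2.1) = l (Z.1, 0) + l (0, Z.2.1) := by rw [← map_add]; simp
      rw [h1, h3, this, ← h2]
      simp
  refine Iff.trans (forall_congr' fun Z => ?_) (key X (velocity x) (momentum x) _)
  rw [Omega_eq]
  rfl

end Equations

/-! ### The equations of motion on `M₁` and the velocity of a solution. -/

section ImageEquations
variable {E : Type*} [NormedAddCommGroup E] [NormedSpace ℝ E]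
    {Q : Type*} [TopologicalSpace Q] [ChartedSpace E Q] [IsManifold 𝓘(ℝ, E) ∞ Q]
    {L : TQ E Q → ℝ}

theorem hasDerivAt_energy (hL : ContMDiff (ITan E) 𝓘(ℝ, ℝ) ∞ L) {v : TQ E Q} {U : E × E}
    {c : ℝ → E × E} (h0 : c 0 = tanChart v.proj v) (hc : HasDerivAt c U 0) :
    HasDerivAt (fun t => energy L ((tanChart v.proj).symm (c t)))
      ((fderiv ℝ (legLoc L v.proj) (tanChart v.proj v) U).2 (v.2 : E) -
        fderiv ℝ (lagrLoc L v.proj) (tanChart v.proj v) (U.1, 0)) 0 := by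
  obtain ⟨l, hl1, hl2⟩ := hasFDerivAt_energyLoc hL (tanChart_fst_mem v)
  have h2 : (tanChart v.proj v).2 = (v.2 : E) := congrArg Prod.snd (tanChart_self v)
  rw [← h2, ← hl2]
  rw [← h0] at hl1
  refine (hl1.comp_hasDerivAt (0 : ℝ) hc).congr_of_eventuallyEq ?_
  have ht : ∀ᶠ t in 𝓝 (0 : ℝ), c t ∈ (extChartAt (ITan E) v).target := by
    refine hc.continuousAt.eventually ?_
    rw [h0]
    exact extChartAt_target_mem_nhds v
  filter_upwards [ht] with t ht
  rw [energy_eq hL (proj_tanChart_symm (mem_target_iff_tan.1 ht)),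
    (tanChart v.proj).right_inv ht]
  rfl

theorem isCurveIn_FL (hL : ContMDiff (ITan E) 𝓘(ℝ, ℝ) ∞ L) {v : TQ E Q} {U : E × E}
    {c : ℝ → E × E} (h0 : c 0 = tanChart v.proj v) (hc : HasDerivAt c U 0)
    (hs : ∀ᶠ t in 𝓝 (0 : ℝ), ContDiffAt ℝ ∞ c t) :
    IsCurveIn (ICot E) (range (FL L)) (FL L v)
      (fderiv ℝ (legLoc L v.proj) (tanChart v.proj v) U)
      (fun t => FL L ((tanChart v.proj).symm (c t))) := by
  have h1 : IsCurveIn (ITan E) univ v U ((extChartAt (ITan E) v).symm ∘ c) :=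
    isCurveIn_chart h0 hs hc (Filter.Eventually.of_forall fun t => mem_univ _)
  have h2 := h1.map (contMDiff_FL hL) (S' := range (FL L)) (fun u _ => ⟨u, rfl⟩)
  exact mfderiv_FL hL v U ▸ h2

variable [FiniteDimensional ℝ E]

/-- The equations of motion on the image of the Legendre transformation, pulled back to
velocities. -/
theorem solves_image_iff (hL : ContMDiff (ITan E) 𝓘(ℝ, ℝ) ∞ L) (hreg : AlmostRegular L)
    {v : TQ E Q} {α : TstarQ E Q} (hα : FL L v = α) {Y : TangentSpace (ICot E) α} :
    Solves (ICot E) (range (FL L)) OmegaQ (h₁ L) α Y ↔ ∀ U : E × E,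
      (fderiv ℝ (legLoc L v.proj) (tanChart v.proj v) U).2 (Y : E × (E →L[ℝ] ℝ)).1 -
        (Y : E × (E →L[ℝ] ℝ)).2 U.1 =
      (fderiv ℝ (legLoc L v.proj) (tanChart v.proj v) U).2 (v.2 : E) -
        fderiv ℝ (lagrLoc L v.proj) (tanChart v.proj v) (U.1, 0) := by
  subst hα
  have hfst : ∀ U : E × E, (fderiv ℝ (legLoc L v.proj) (tanChart v.proj v) U).1 = U.1 := fun U => by
    rw [fderiv_legLoc hL (tanChart_fst_mem v)]
  have hO : ∀ U : E × E, OmegaQ (FL L v) Y (fderiv ℝ (legLoc L v.proj) (tanChart v.proj v) U) =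
      (fderiv ℝ (legLoc L v.proj) (tanChart v.proj v) U).2 (Y : E × (E →L[ℝ] ℝ)).1 -
        (Y : E × (E →L[ℝ] ℝ)).2 U.1 := fun U => by
    refine (OmegaQ_eq _ _ _).trans ?_
    exact congrArg (fun u => _ - (Y : E × (E →L[ℝ] ℝ)).2 u) (hfst U)
  have hen : ∀ c : ℝ → E × E, (h₁ L ∘ fun t => FL L ((tanChart v.proj).symm (c t))) =
      fun t => energy L ((tanChart v.proj).symm (c t)) :=
    fun c => funext fun t => hreg.h₁_FL hL _
  constructor
  · intro h U
    have hc : HasDerivAt (fun t : ℝ => tanChart v.proj v + t • U) U 0 := by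
      simpa using ((hasDerivAt_id (0 : ℝ)).smul_const U).const_add (tanChart v.proj v)
    have hc0 : (fun t : ℝ => tanChart v.proj v + t • U) 0 = tanChart v.proj v := by simp
    have hs : ∀ᶠ t in 𝓝 (0 : ℝ), ContDiffAt ℝ ∞ (fun t : ℝ => tanChart v.proj v + t • U) t :=
      Filter.Eventually.of_forall fun t =>
        (contDiff_const.add (contDiff_id.smul contDiff_const)).contDiffAt
    have h1 := h _ _ (isCurveIn_FL hL hc0 hc hs)
    rw [hen] at h1
    rw [← hO]
    exact h1.unique (hasDerivAt_energy hL hc0 hc)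
  · intro h Z γ hγ
    -- A test curve in `M₁` is the image of a curve in `TQ`, so its velocity is `TFL(U)` and `h₁`
    -- along it is the energy of the lift.
    obtain ⟨c, hc0, hcs, hcγ⟩ := hreg.exists_lift hL v hγ
    have hc : HasDerivAt c (deriv c 0) 0 :=
      (hcs.self_of_nhds.differentiableAt (by simp)).hasDerivAt
    have hZ := hγ.velocity_unique (isCurveIn_FL hL hc0 hc hcs) (hcγ.mono fun t ht => ht.symm)
    subst hZ
    rw [hO, h]
    refine (hasDerivAt_energy hL hc0 hc).congr_of_eventuallyEq ?_
    filter_upwards [hcγ] with t ht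
    rw [← hreg.h₁_FL hL, ht]
    rfl

/-- A solution on the Whitney sum projects to a solution on the image of the Legendre
transformation. -/
theorem Solves.map_pr₂ (hL : ContMDiff (ITan E) 𝓘(ℝ, ℝ) ∞ L) (hreg : AlmostRegular L)
    {x : Whitney E Q} {X : TangentSpace (IWh E) x} (h : Solves (IWh E) univ Omega (D L) x X) :
    Solves (ICot E) (range (FL L)) OmegaQ (h₁ L) (pr₂ x) (mfderiv (IWh E) (ICot E) pr₂ x X) := by
  obtain ⟨h1, h2, h3⟩ := (solves_whitney_iff hL).1 h
  rw [solves_image_iff hL hreg h2, mfderiv_pr₂]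
  intro U
  refine congrArg₂ (· - ·) (congrArg _ h1) (h3 U.1)

/-- The part `ṗ = ∂L/∂q` of the equations of motion on the image of the Legendre transformation. -/
theorem Solves.momentum_eq (hL : ContMDiff (ITan E) 𝓘(ℝ, ℝ) ∞ L) (hreg : AlmostRegular L)
    {v : TQ E Q} {α : TstarQ E Q} (hα : FL L v = α) {Y : TangentSpace (ICot E) α}
    (h : Solves (ICot E) (range (FL L)) OmegaQ (h₁ L) α Y)
    (hY : (Y : E × (E →L[ℝ] ℝ)).1 = (v.2 : E)) (u : E) :
    (Y : E × (E →L[ℝ] ℝ)).2 u = fderiv ℝ (lagrLoc L v.proj) (tanChart v.proj v) (u, 0) := by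
  have h1 := (solves_image_iff hL hreg hα).1 h (u, 0)
  rw [hY] at h1
  linarith

/-- At each point `v` of a fibre of the Legendre transformation, `q̇ - v` is tangent to the
fibre. -/
theorem Solves.fderiv_legLoc_eq_zero (hL : ContMDiff (ITan E) 𝓘(ℝ, ℝ) ∞ L)
    (hreg : AlmostRegular L) {q : Q} {w : E} {α : TstarQ E Q} (hα : FL L ⟨q, w⟩ = α)
    {Y : TangentSpace (ICot E) α} (h : Solves (ICot E) (range (FL L)) OmegaQ (h₁ L) α Y) :
    fderiv ℝ (legLoc L q) (tanChart q (⟨q, w⟩ : TQ E Q)) (0, (Y : E × (E →L[ℝ] ℝ)).1 - w) = 0 := by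
  have h1 := (solves_image_iff hL hreg hα).1 h
  have hsymm : IsSymmSndFDerivAt ℝ (lagrLoc L q) (tanChart q (⟨q, w⟩ : TQ E Q)) :=
    (contDiffAt_lagrLoc hL (tanChart_fst_mem (⟨q, w⟩ : TQ E Q))).isSymmSndFDerivAt
      (by simpa using ENat.LEInfty.out)
  have key : ∀ (a b : E) (p : E →L[ℝ] ℝ), (∀ U : E × E,
      (fderiv ℝ (legLoc L q) (tanChart q (⟨q, w⟩ : TQ E Q)) U).2 a - p U.1 =
      (fderiv ℝ (legLoc L q) (tanChart q (⟨q, w⟩ : TQ E Q)) U).2 b -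
        fderiv ℝ (lagrLoc L q) (tanChart q (⟨q, w⟩ : TQ E Q)) (U.1, 0)) →
      fderiv ℝ (legLoc L q) (tanChart q (⟨q, w⟩ : TQ E Q)) (0, a - b) = 0 := by
    intro a b p h
    rw [fderiv_legLoc hL (tanChart_fst_mem (⟨q, w⟩ : TQ E Q))]
    refine Prod.ext rfl ?_
    ext u
    -- For vertical test vectors the terms `ṗ` and `∂L/∂q` drop out: `L_vv(u, a) = L_vv(u, b)`
    -- remains, and symmetry of the Hessian moves `a - b` into the first slot.
    have h2 := h (0, u)
    rw [fderiv_legLoc hL (tanChart_fst_mem (⟨q, w⟩ : TQ E Q))] at h2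
    have h3 : fderiv ℝ (lagrLoc L q) (tanChart q (⟨q, w⟩ : TQ E Q)) ((0 : E), (0 : E)) = 0 :=
      map_zero _
    simp only [map_zero, h3, sub_zero, ContinuousLinearMap.comp_apply,
      ContinuousLinearMap.inr_apply] at h2
    have h4 : ((0 : E), a - b) = (0, a) - (0, b) := by simp
    change fderiv ℝ (fderiv ℝ (lagrLoc L q)) (tanChart q (⟨q, w⟩ : TQ E Q)) (0, a - b) (0, u) = 0
    rw [hsymm, h4, map_sub, h2, sub_self]
  exact key _ _ _ h1

/-- If `Y` solves the equations of motion at a point `α` of the image of the Legendre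
transformation, then the velocity `q̇` of `Y` lies in the fibre over `α`. -/
theorem Solves.FL_velocity (hL : ContMDiff (ITan E) 𝓘(ℝ, ℝ) ∞ L) (hreg : AlmostRegular L)
    {α : TstarQ E Q} (hα : α ∈ range (FL L)) {Y : TangentSpace (ICot E) α}
    (h : Solves (ICot E) (range (FL L)) OmegaQ (h₁ L) α Y) :
    FL L ⟨α.proj, (Y : E × (E →L[ℝ] ℝ)).1⟩ = α := by
  have hself : ∀ u : E, tanChart α.proj (⟨α.proj, u⟩ : TQ E Q) = (chartAt E α.proj α.proj, u) :=
    fun u => tanChart_self (⟨α.proj, u⟩ : TQ E Q)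
  have hFL : ∀ u : E, cotChart α.proj (FL L ⟨α.proj, u⟩) =
      legLoc L α.proj (chartAt E α.proj α.proj, u) := fun u => by
    rw [← hself]
    exact cotChart_FL hL (mem_chart_source E α.proj)
  let F : Set E := {u | legLoc L α.proj (chartAt E α.proj α.proj, u) = cotChart α.proj α}
  have hF : ∀ u : E, u ∈ F ↔ FL L ⟨α.proj, u⟩ = α := by
    intro u
    change legLoc L α.proj _ = _ ↔ _
    rw [← hFL]
    exact (extChartAt (ICot E) α).injOn.eq_iff
      (by rw [extChartAt_cot, cotChart_source]; exact mem_chart_source E α.proj)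
      (mem_extChartAt_source α)
  refine (hF _).1 (mem_of_tangent_direction ?_ ?_ _ ?_)
  · refine isClosed_eq ?_ continuous_const
    rw [continuous_iff_continuousAt]
    intro u
    refine ContinuousAt.comp (g := legLoc L α.proj) ?_ (by fun_prop)
    exact (contDiffAt_legLoc hL (mem_chart_target E α.proj)).continuousAt
  · obtain ⟨⟨q, v⟩, rfl⟩ := hα
    exact ⟨v, (hF v).2 rfl⟩
  -- The curve lives in `TQ`, but along it `legLoc` is constant and records the base point, so its
  -- vector part moves inside the single tangent space at `α.proj`.
  · intro u hu
    have h1 := h.fderiv_legLoc_eq_zero hL hreg ((hF u).1 hu)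
    obtain ⟨c, hc0, hcd, hc⟩ := hreg.exists_curve_in_fibre hL (⟨α.proj, u⟩ : TQ E Q) h1
    rw [hself] at hc0
    refine ⟨fun t => (c t).2, congrArg Prod.snd hc0, hcd.snd, ?_⟩
    filter_upwards [hc] with t ht
    rw [hself] at ht
    have h2 : (c t).1 = chartAt E α.proj α.proj := congrArg Prod.fst ht
    have hu' : legLoc L α.proj (chartAt E α.proj α.proj, u) = cotChart α.proj α := hu
    change legLoc L α.proj (_, (c t).2) = _
    rw [← h2, ← hu', ← ht]

end ImageEquations

/-! ### Comparison of the two constraint sequences. -/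

section Algorithm

section General
variable {F : Type*} [NormedAddCommGroup F] [NormedSpace ℝ F]
  {H : Type*} [TopologicalSpace H] {I : ModelWithCorners ℝ F H}
  {N : Type*} [TopologicalSpace N] [ChartedSpace H N]
  {S : Set N} {η : ∀ x : N, TangentSpace I x → TangentSpace I x → ℝ} {h : N → ℝ}

theorem constraintSet_succ_subset (k : ℕ) :
    constraintSet I S η h (k + 1) ⊆ constraintSet I S η h k := fun _ hx => hx.1

theorem constraintSet_antitone : Antitone (constraintSet I S η h) :=
  antitone_nat_of_succ_le constraintSet_succ_subset

/-- Each constraint set is determined by the preceding one, so one repetition forces all later sets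
to agree. -/
theorem constraintSet_stable {k : ℕ} (hk : constraintSet I S η h (k + 1) = constraintSet I S η h k)
    (m : ℕ) : constraintSet I S η h (k + m) = constraintSet I S η h k := by
  induction m with
  | zero => rfl
  | succ m ih =>
    rw [← hk, ← add_assoc]
    simp only [constraintSet, ih]

end General

variable {E : Type*} [NormedAddCommGroup E] [NormedSpace ℝ E] [FiniteDimensional ℝ E]
    {Q : Type*} [TopologicalSpace Q] [ChartedSpace E Q] [IsManifold 𝓘(ℝ, E) ∞ Q]
    {L : TQ E Q → ℝ}

omit [FiniteDimensional ℝ E] in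
theorem mapsTo_pr₂_W_one (hL : ContMDiff (ITan E) 𝓘(ℝ, ℝ) ∞ L) :
    MapsTo pr₂ (W L 1) (range (FL L)) := by
  rintro x ⟨-, X, -, hX⟩
  exact ⟨_, ((solves_whitney_iff hL).1 hX).2.1⟩

/-- The induction starts at `W L 1`, where `p = ∂L/∂v` first holds. The shift in `M` makes `M L 1`
the image of `FL`. A solution tangent to one set is pushed forward to a solution tangent to the next
image set. -/
theorem mapsTo_pr₂_W (hL : ContMDiff (ITan E) 𝓘(ℝ, ℝ) ∞ L) (hreg : AlmostRegular L) (m : ℕ) :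
    MapsTo pr₂ (W L (m + 1)) (M L (m + 1)) := by
  induction m with
  | zero => exact mapsTo_pr₂_W_one hL
  | succ m ih =>
    rintro x ⟨hx, X, hX, hXs⟩
    exact ⟨ih hx, mfderiv (IWh E) (ICot E) pr₂ x X, tangentTo_map hX contMDiff_pr₂ ih,
      hXs.map_pr₂ hL hreg⟩

/-- The points of a set `C` of solutions lift to all constraint sets of the Whitney sum. -/
theorem lift_mem_W (hL : ContMDiff (ITan E) 𝓘(ℝ, ℝ) ∞ L) (hreg : AlmostRegular L)
    {C U : Set (TstarQ E Q)} (hU : IsOpen U) (hC : C ⊆ range (FL L))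
    {Y : ∀ z : TstarQ E Q, TangentSpace (ICot E) z}
    (hYs : ContMDiffOn (ICot E) (ICot E).tangent ∞
      (fun z => (⟨z, Y z⟩ : TangentBundle (ICot E) (TstarQ E Q))) (C ∩ U))
    (hY : ∀ z ∈ C ∩ U, Y z ∈ tangentTo (ICot E) C z ∧
      Solves (ICot E) (range (FL L)) OmegaQ (h₁ L) z (Y z)) (k : ℕ) :
    ∀ z ∈ C ∩ U, (⟨z.proj, (mfderiv (ICot E) 𝓘(ℝ, E) piQ z (Y z), z.2)⟩ : Whitney E Q) ∈ W L k := by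
  set x : TstarQ E Q → Whitney E Q :=
    fun z => ⟨z.proj, (mfderiv (ICot E) 𝓘(ℝ, E) piQ z (Y z), z.2)⟩ with hx
  have hxs : ContMDiffOn (ICot E) (IWh E) ∞ x (C ∩ U) := by
    intro z hz
    -- The first component of the lift is the tangent map of `piQ` composed with `Y`; the second is
    -- the identity.
    refine contMDiffWithinAt_whitney ?_ contMDiffWithinAt_id
    exact (contMDiff_piQ.contMDiff_tangentMap (m := ∞) (by simp)).contMDiffAt.comp_contMDiffWithinAt
      z (hYs z hz)
  have hFL : ∀ z ∈ C ∩ U, FL L (pr₁ (x z)) = z := fun z hz => by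
    have h1 := (hY z hz).2.FL_velocity hL hreg (hC hz.1)
    refine Eq.trans (congrArg (fun u : E => FL L ⟨z.proj, u⟩) (mfderiv_piQ z (Y z))) h1
  induction k with
  | zero => exact fun z _ => mem_univ _
  | succ k ih =>
    intro z hz
    refine ⟨ih z hz, ?_⟩
    obtain ⟨⟨γ, hγ⟩, hsol⟩ := hY z hz
    have hcont := hγ.eventually_contMDiffAt.self_of_nhds.continuousAt
    have hγU : ∀ᶠ t in 𝓝 (0 : ℝ), γ t ∈ C ∩ U := by
      have : ∀ᶠ t in 𝓝 (0 : ℝ), γ t ∈ U :=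
        hcont.eventually (by rw [hγ.apply_zero]; exact hU.mem_nhds hz.2)
      exact hγ.eventually_mem.and this
    have hs : ∀ᶠ t in 𝓝 (0 : ℝ), ContMDiffAt 𝓘(ℝ, ℝ) (IWh E) ∞ (x ∘ γ) t := by
      filter_upwards [hγU.eventually_nhds, hγ.eventually_contMDiffAt] with t h1 h2
      exact ((hxs (γ t) h1.self_of_nhds).comp t
        (h2.contMDiffWithinAt (s := γ ⁻¹' (C ∩ U))) (mapsTo_preimage _ _)).contMDiffAt h1
    have hγ0 := hγ.apply_zero
    have hX := isCurveIn_of_mfderiv (S := W L k) (hγU.mono fun t ht => ih _ ht) hs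
    have hX' : ∃ X, IsCurveIn (IWh E) (W L k) (x z) X (x ∘ γ) := by
      rw [← hγ0]
      exact ⟨_, hX⟩
    obtain ⟨X, hX⟩ := hX'
    refine ⟨X, ⟨_, hX⟩, ?_⟩
    -- Since `pr₂ ∘ x ∘ γ = γ`, the components `q̇` and `ṗ` of `X` are those of `Y z`; the equation
    -- does not involve the remaining component `v̇`.
    have h2 : mfderiv (IWh E) (ICot E) pr₂ (x z) X = Y z :=
      (hX.map contMDiff_pr₂ (mapsTo_image pr₂ _)).velocity_unique hγ
        (Filter.Eventually.of_forall fun _ => rfl)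
    rw [mfderiv_pr₂] at h2
    rw [solves_whitney_iff hL]
    have h3 : (Y z : E × (E →L[ℝ] ℝ)).1 = velocity (x z) := (mfderiv_piQ z (Y z)).symm
    refine ⟨(congrArg Prod.fst h2).trans h3, hFL z hz, fun u => ?_⟩
    exact (congrArg (fun w : E × (E →L[ℝ] ℝ) => w.2 u) h2).trans
      (hsol.momentum_eq hL hreg (hFL z hz) h3 u)

omit [FiniteDimensional ℝ E] in
theorem M_subset_range {j : ℕ} : M L j ⊆ range (FL L) :=
  constraintSet_antitone (Nat.zero_le _)

theorem M_subset_pr₂_image_W (hL : ContMDiff (ITan E) 𝓘(ℝ, ℝ) ∞ L) (hreg : AlmostRegular L)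
    {j : ℕ} (hsol : HasSmoothSolutions L (M L j)) (i : ℕ) : M L j ⊆ pr₂ '' W L i := by
  intro y hy
  obtain ⟨U, hU, Y, hYs, hY⟩ := hsol y hy
  have hsub : M L j ∩ interior U ⊆ M L j ∩ U := inter_subset_inter_right _ interior_subset
  exact ⟨_, lift_mem_W hL hreg isOpen_interior M_subset_range (hYs.mono hsub)
    (fun z hz => hY z (hsub hz)) i y ⟨hy, mem_interior_iff_mem_nhds.2 hU⟩, rfl⟩

end Algorithm

end SkinnerRusk

end

open SkinnerRusk
theorem mainTheorem3
    {E : Type*} [NormedAddCommGroup E] [NormedSpace ℝ E] [FiniteDimensional ℝ E]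
    {Q : Type*} [TopologicalSpace Q] [T2Space Q] [SecondCountableTopology Q]
    [ChartedSpace E Q] [IsManifold 𝓘(ℝ, E) ∞ Q]
    (L : TQ E Q → ℝ) (hL : ContMDiff (ITan E) 𝓘(ℝ, ℝ) ∞ L) (hreg : AlmostRegular L) :
    -- (i)
    (∀ p ∈ W L 1, ∀ X ∈ tangentTo (IWh E) (W L 1) p,
      Solves (IWh E) univ Omega (D L) p X →
        mfderiv (IWh E) (ICot E) pr₂ p X ∈ tangentTo (ICot E) (M L 1) (pr₂ p) ∧
        Solves (ICot E) (M L 1) OmegaQ (h₁ L) (pr₂ p) (mfderiv (IWh E) (ICot E) pr₂ p X)) ∧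
    -- the constraint sets are submanifolds
    ((∀ k, IsEmbeddedSubmanifold (IWh E) (W L k)) →
     (∀ k, 1 ≤ k → IsEmbeddedSubmanifold (ICot E) (M L k)) →
      -- (ii), first part
      (∀ k, 1 ≤ k → pr₂ '' W L k ⊆ M L k) ∧
      -- `W_f = W_i` and `M_f = M_j` are the final constraint submanifolds
      (∀ i j, W L (i + 1) = W L i → 1 ≤ j → M L (j + 1) = M L j → HasSmoothSolutions L (M L j) →
        -- (ii), second part
        pr₂ '' W L i = M L j ∧
        -- (iii)
        pr '' W L i = piQ '' M L j)) := by
  have hsub : ∀ k, 1 ≤ k → pr₂ '' W L k ⊆ M L k := by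
    intro k hk
    obtain ⟨m, rfl⟩ := Nat.exists_eq_add_of_le' hk
    exact (mapsTo_pr₂_W hL hreg m).image_subset
  refine ⟨fun p _ X hX hXs =>
    ⟨tangentTo_map hX contMDiff_pr₂ (mapsTo_pr₂_W hL hreg 0), hXs.map_pr₂ hL hreg⟩,
    fun _ _ => ⟨hsub, fun i j hi hj hjs hsol => ?_⟩⟩
  have key : pr₂ '' W L i = M L j := by
    refine Subset.antisymm ?_ (M_subset_pr₂_image_W hL hreg hsol i)
    -- The algorithms may stop at different steps, so the inclusion is used at the common index `i +
    -- j`, which is at least `1` even when `i = 0`.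
    have h1 : W L (i + j) = W L i := constraintSet_stable hi j
    have h2 : M L (i + j) ⊆ M L j := constraintSet_antitone (by omega)
    rw [← h1]
    exact (hsub _ (by omega)).trans h2
  refine ⟨key, ?_⟩
  rw [← key, image_image]
  rfl
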